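/- Let $d\ge 1$ be an integer and $\nu\ge 0$ a real number. Let $\mathbb{B}^d$ be the closed Euclidean unit ball of $\mathbb{R}^d$ and let $F_\nu$ be the probability measure on $\mathbb{B}^d$ whose density with respect to Lebesgue measure is proportional to $(1-\|x\|^2)^{\nu-\frac12}$. For an integer $n\ge 1$ let $\mathcal{Y}_n$ be the space of real polynomials in $d$ variables of total degree at most $n$ that are orthogonal in $L^2(\mathbb{B}^d,F_\nu)$ to every polynomial of total degree less than $n$. Then there is a constant $C>0$, depending only on $d$ and $\nu$, such that for every integer $n\ge 1$ and every $L^2(\mathbb{B}^d,F_\nu)$-orthonormal basis $\{p_{k,n}\}_{k=1}^{\dim\mathcal{Y}_n}$ of $\mathcal{Y}_n$, $$\|p_{k,n}\|_\infty\le C\,n^{\nu+\frac{d-1}{2}}\quad\text{for } 1\le k\le\dim\mathcal{Y}_n,\qquad \Big\|\sum_{k=1}^{\dim\mathcal{Y}_n}p_{k,n}^2\Big\|_\infty\le C\,n^{2\nu+d-1},$$ where $\|\cdot\|_\infty$ is the supremum norm on $\mathbb{B}^d$. -/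

import Mathlib

open MeasureTheory

namespace BallPoly

noncomputable section

/-- The closed Euclidean unit ball `𝔹ᵈ` of `ℝᵈ`. -/
abbrev unitBall (d : ℕ) : Set (EuclideanSpace ℝ (Fin d)) :=
  Metric.closedBall 0 1

/-- The measure on `𝔹ᵈ` with the unnormalized density `(1 - ‖x‖²)^(ν - 1/2)`
with respect to Lebesgue measure. -/
def weightMeasure (d : ℕ) (ν : ℝ) : Measure (EuclideanSpace ℝ (Fin d)) :=
  (volume.restrict (unitBall d)).withDensity
    fun x => ENNReal.ofReal ((1 - ‖x‖ ^ 2) ^ (ν - 1 / 2))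

/-- The distribution `F_ν` on `𝔹ᵈ`: the previous measure divided by its total mass (which is
finite and nonzero for `ν > -1/2`). -/
def F (d : ℕ) (ν : ℝ) : Measure (EuclideanSpace ℝ (Fin d)) :=
  (weightMeasure d ν Set.univ)⁻¹ • weightMeasure d ν

/-- The polynomial function on `ℝᵈ` given by a polynomial in `d` variables. -/
def polyFun {d : ℕ} (p : MvPolynomial (Fin d) ℝ) (x : EuclideanSpace ℝ (Fin d)) : ℝ :=
  MvPolynomial.eval (fun i => x i) p

/-- The inner product of `L²(𝔹ᵈ, F_ν)` on polynomials. -/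
def polyInner (d : ℕ) (ν : ℝ) (p q : MvPolynomial (Fin d) ℝ) : ℝ :=
  ∫ x, polyFun p x * polyFun q x ∂(F d ν)

theorem continuous_polyFun {d : ℕ} (p : MvPolynomial (Fin d) ℝ) : Continuous (polyFun p) := by
  unfold polyFun
  exact (MvPolynomial.continuous_eval p).comp (by fun_prop)

instance isFiniteMeasure_F (d : ℕ) (ν : ℝ) : IsFiniteMeasure (F d ν) := by
  refine ⟨?_⟩
  simp only [F, Measure.smul_apply, smul_eq_mul]
  exact lt_of_le_of_lt (ENNReal.inv_mul_le_one _) ENNReal.one_lt_top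

theorem ae_mem_unitBall (d : ℕ) (ν : ℝ) : ∀ᵐ x ∂(F d ν), x ∈ unitBall d := by
  refine Measure.ae_smul_measure ?_ _
  refine (withDensity_absolutelyContinuous _ _).ae_le ?_
  exact ae_restrict_mem Metric.isClosed_closedBall.measurableSet

theorem integrable_of_continuous {d : ℕ} {ν : ℝ} {f : EuclideanSpace ℝ (Fin d) → ℝ}
    (hf : Continuous f) : Integrable f (F d ν) := by
  obtain ⟨M, hM⟩ := (isCompact_closedBall (0 : EuclideanSpace ℝ (Fin d)) 1).exists_bound_of_continuousOn
    hf.continuousOn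
  refine Integrable.of_bound hf.aestronglyMeasurable M ?_
  filter_upwards [ae_mem_unitBall d ν] with x hx using hM x hx

theorem integrable_mul (d : ℕ) (ν : ℝ) (p q : MvPolynomial (Fin d) ℝ) :
    Integrable (fun x => polyFun p x * polyFun q x) (F d ν) :=
  integrable_of_continuous ((continuous_polyFun p).mul (continuous_polyFun q))

/-- The space `𝒴ₙ` of orthogonal polynomials of degree `n` in `d` variables for `F_ν`: the
polynomials of total degree at most `n` that are orthogonal to all polynomials of degree less
than `n`. -/
def Y (d : ℕ) (ν : ℝ) (n : ℕ) : Submodule ℝ (MvPolynomial (Fin d) ℝ) where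
  carrier := {p | p.totalDegree ≤ n ∧
    ∀ q : MvPolynomial (Fin d) ℝ, q.totalDegree < n → polyInner d ν p q = 0}
  zero_mem' := by simp [polyInner, polyFun]
  add_mem' := by
    rintro a b ⟨ha, ha'⟩ ⟨hb, hb'⟩
    refine ⟨(MvPolynomial.totalDegree_add a b).trans (max_le ha hb), fun q hq => ?_⟩
    have h : polyInner d ν (a + b) q = polyInner d ν a q + polyInner d ν b q := by
      unfold polyInner
      rw [← integral_add (integrable_mul d ν a q) (integrable_mul d ν b q)]
      simp [polyFun, add_mul]
    rw [h, ha' q hq, hb' q hq, add_zero]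
  smul_mem' := by
    rintro c a ⟨ha, ha'⟩
    refine ⟨(MvPolynomial.totalDegree_smul_le c a).trans ha, fun q hq => ?_⟩
    have h : polyInner d ν (c • a) q = c * polyInner d ν a q := by
      unfold polyInner
      rw [← integral_const_mul]
      simp [polyFun, mul_assoc]
    rw [h, ha' q hq, mul_zero]

/-- The restriction of a polynomial to `𝔹ᵈ`; its norm in `C(𝔹ᵈ, ℝ)` is the sup norm on `𝔹ᵈ`. -/
def onBall {d : ℕ} (p : MvPolynomial (Fin d) ℝ) : C(unitBall d, ℝ) :=
  ⟨fun x => polyFun p x, (continuous_polyFun p).comp continuous_subtype_val⟩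

/-- A basis of `𝒴ₙ` that is orthonormal in `L²(𝔹ᵈ, F_ν)`. -/
def IsOrthonormalBasis {d : ℕ} {ν : ℝ} {n : ℕ}
    (p : Module.Basis (Fin (Module.finrank ℝ (Y d ν n))) ℝ (Y d ν n)) : Prop :=
  ∀ j k, polyInner d ν (p j) (p k) = if j = k then 1 else 0

end

end BallPoly

/-! With λ = ν + (d-1)/2, everything follows from the point evaluation bound q(x)² ≤ K n^(2λ) ‖q‖²
for q in 𝒴ₙ and ‖x‖ ≤ 1 (`polyFun_sq_le`). Applied to q = ∑ pₖ(x) pₖ it gives S² ≤ K n^(2λ) S for S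
= ∑ pₖ(x)², which bounds the sum of squares and each of its terms.

The point evaluation bound is reduced to one variable. Draw y from F_ν and an independent t with
density proportional to (1-t²)^(ν-1) (a random sign if ν = 0). The point (y, t√(1-‖y‖²)) of ℝᵈ⁺¹ has
a rotation-invariant law, seen here through its moments (`integral_lift_pow`). Its inner product s
with the unit vector (x, √(1-‖x‖²)) has the Gegenbauer weight (1-s²)^(λ-1/2). The conditional
expectation of q(y) given s is a polynomial g(s) of degree at most n with g(1) = q(x). This is
checked on powers of linear forms, which span (`linForm_pow_mem_averaged`,
`mem_of_linForm_pow_mem`). Averaging s^k over t gives a polynomial in y of degree at most k, so q ∈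
𝒴ₙ makes g orthogonal to lower degrees; conditioning does not increase the L² norm.

Hence g is a multiple of the Gegenbauer polynomial of degree n, whose norm relative to its value at
1 is explicit (`functional_sq_eq`) and is estimated by `poch_div_le`. -/

namespace BallPoly

noncomputable section

open Polynomial

/-! ### Rising factorials and Jacobi polynomials -/

/-- The rising factorial `x (x + 1) ⋯ (x + n - 1)`. -/
def poch (x : ℝ) (n : ℕ) : ℝ := ∏ j ∈ Finset.range n, (x + j)

@[simp] theorem poch_zero (x : ℝ) : poch x 0 = 1 := by simp [poch]

theorem poch_succ (x : ℝ) (n : ℕ) : poch x (n + 1) = poch x n * (x + n) := by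
  simp [poch, Finset.prod_range_succ]

theorem poch_add (x : ℝ) (m n : ℕ) : poch x (m + n) = poch x m * poch (x + m) n := by
  simp [poch, Finset.prod_range_add, add_assoc]

theorem poch_succ_left (x : ℝ) (n : ℕ) : poch x (n + 1) = x * poch (x + 1) n := by
  rw [add_comm, poch_add]; simp [poch]

theorem poch_pos {x : ℝ} (hx : 0 < x) (n : ℕ) : 0 < poch x n :=
  Finset.prod_pos fun j _ => by positivity

theorem poch_one (n : ℕ) : poch 1 n = n.factorial := by
  induction n with
  | zero => simp
  | succ n ih => rw [poch_succ, ih, Nat.factorial_succ]; push_cast; ring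

theorem poch_eq_zero {n m : ℕ} (h : m < n) : poch ((m : ℝ) + 1 - n) n = 0 := by
  refine Finset.prod_eq_zero (i := n - (m + 1)) (by simp; omega) ?_
  rw [Nat.cast_sub (by omega)]; push_cast; ring

/-- The Chu–Vandermonde identity. -/
theorem chu_vandermonde (n : ℕ) (b c : ℝ) (hc : 0 < c) :
    ∑ k ∈ Finset.range (n + 1), (-1) ^ k * (n.choose k : ℝ) * (poch b k / poch c k) =
      poch (c - b) n / poch c n := by
  induction n generalizing b c with
  | zero => simp
  | succ n ih =>
    have h1 := ih b c hc
    have h2 := ih (b + 1) (c + 1) (by linarith)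
    have key : ∑ k ∈ Finset.range (n + 1 + 1),
        (-1) ^ k * ((n + 1).choose k : ℝ) * (poch b k / poch c k) =
        (∑ k ∈ Finset.range (n + 1), (-1) ^ k * (n.choose k : ℝ) * (poch b k / poch c k)) -
        b / c * ∑ k ∈ Finset.range (n + 1),
          (-1) ^ k * (n.choose k : ℝ) * (poch (b + 1) k / poch (c + 1) k) := by
      have e : ∑ k ∈ Finset.range (n + 1), (-1) ^ k * (n.choose k : ℝ) * (poch b k / poch c k) =
          ∑ k ∈ Finset.range (n + 1 + 1),
            (-1) ^ k * (n.choose k : ℝ) * (poch b k / poch c k) := by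
        rw [Finset.sum_range_succ _ (n + 1)]; simp
      rw [e, Finset.sum_range_succ', Finset.sum_range_succ' _ (n + 1), Finset.mul_sum,
        add_sub_right_comm, ← Finset.sum_sub_distrib]
      congr 1
      · refine Finset.sum_congr rfl fun k _ => ?_
        have := poch_pos (x := c + 1) (by linarith) k
        rw [Nat.choose_succ_succ, poch_succ_left, poch_succ_left]
        push_cast
        field_simp
        ring
      · simp
    have p1 := poch_pos hc n
    have p2 := poch_pos (x := c + 1) (by linarith) n
    have p3 : 0 < c + n := by positivity
    have e1 : poch c n * (c + n) = c * poch (c + 1) n := by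
      rw [← poch_succ, poch_succ_left]
    rw [key, h1, h2, poch_succ, poch_succ, show c + 1 - (b + 1) = c - b by ring]
    have e2 : poch (c + 1) n = poch c n * (c + n) / c := by field_simp; linarith
    rw [e2]
    field_simp
    ring

/-- The Jacobi polynomial with equal parameters `a - 1`, on `[0, 1]`, with value `1` at `1`. -/
def jacobi (a : ℝ) (n : ℕ) : ℝ[X] :=
  ∑ k ∈ Finset.range (n + 1),
    C ((-1) ^ k * (n.choose k : ℝ) * (poch (n + 2 * a - 1) k / poch a k)) * (1 - X) ^ k

theorem natDegree_one_sub_X_pow_le (k : ℕ) : ((1 - X : ℝ[X]) ^ k).natDegree ≤ k := by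
  compute_degree

theorem coeff_one_sub_X_pow (k : ℕ) : ((1 - X : ℝ[X]) ^ k).coeff k = (-1) ^ k := by
  have := coeff_pow_of_natDegree_le (p := (1 - X : ℝ[X])) (n := 1) (m := k) (by compute_degree)
  simpa [coeff_one] using this

theorem natDegree_jacobi_le (a : ℝ) (n : ℕ) : (jacobi a n).natDegree ≤ n := by
  refine natDegree_sum_le_of_forall_le _ _ fun k hk => ?_
  refine (natDegree_C_mul_le _ _).trans ((natDegree_one_sub_X_pow_le k).trans ?_)
  simp at hk; omega

theorem coeff_jacobi (a : ℝ) (n : ℕ) :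
    (jacobi a n).coeff n = poch (n + 2 * a - 1) n / poch a n := by
  rw [jacobi, finsetSum_coeff, Finset.sum_range_succ, Finset.sum_eq_zero]
  · rw [coeff_C_mul, coeff_one_sub_X_pow]
    have : ((-1 : ℝ) ^ n) * (-1) ^ n = 1 := by rw [← mul_pow]; simp
    simp only [Nat.choose_self, Nat.cast_one, zero_add]
    linear_combination (poch (n + 2 * a - 1) n / poch a n) * this
  · intro k hk
    rw [coeff_C_mul, coeff_eq_zero_of_natDegree_lt, mul_zero]
    exact (natDegree_one_sub_X_pow_le k).trans_lt (by simpa using hk)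

theorem eval_one_jacobi (a : ℝ) (n : ℕ) : (jacobi a n).eval 1 = 1 := by
  rw [jacobi, eval_finsetSum, Finset.sum_range_succ', Finset.sum_eq_zero]
  · simp
  · intro k _; simp

/-! ### Orthogonality and norms for a functional with beta moments -/

section Functional

variable {E : ℝ[X] →ₗ[ℝ] ℝ} {a : ℝ}

theorem functional_mul_eq_zero {g : ℝ[X]} {n : ℕ} (hg : ∀ m < n, E (g * X ^ m) = 0) {f : ℝ[X]}
    (hf : f.natDegree < n) : E (g * f) = 0 := by
  rw [f.as_sum_range' n hf, Finset.mul_sum, map_sum]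
  refine Finset.sum_eq_zero fun m hm => ?_
  rw [← C_mul_X_pow_eq_monomial, mul_left_comm, ← smul_eq_C_mul, map_smul,
    hg m (by simpa using hm), smul_zero]

theorem functional_mul_eq_coeff {g : ℝ[X]} {n : ℕ} (hg : ∀ m < n, E (g * X ^ m) = 0) {f : ℝ[X]}
    (hf : f.natDegree ≤ n) : E (g * f) = f.coeff n * E (g * X ^ n) := by
  rw [f.as_sum_range' (n + 1) (by omega), Finset.mul_sum, map_sum, Finset.sum_range_succ,
    Finset.sum_eq_zero, zero_add]
  · rw [← C_mul_X_pow_eq_monomial, mul_left_comm, ← smul_eq_C_mul, map_smul, smul_eq_mul,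
      ← f.as_sum_range' (n + 1) (by omega)]
  · intro m hm
    rw [← C_mul_X_pow_eq_monomial, mul_left_comm, ← smul_eq_C_mul, map_smul,
      hg m (by simpa using hm), smul_zero]

/-- Expanding in powers of 1 - X leaves a Chu–Vandermonde sum. The factor `poch (m + 1 - n) n`
contains 0 when m < n, which is orthogonality; at m = n it is n!, which gives the norm. -/
theorem functional_jacobi_mul_X_pow (ha : 0 < a)
    (hE : ∀ k m, E (X ^ m * (1 - X) ^ k) = poch a k * poch a m / poch (2 * a) (k + m)) (n m : ℕ) :
    E (jacobi a n * X ^ m) =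
      poch a m / poch (2 * a) m * (poch ((m : ℝ) + 1 - n) n / poch (2 * a + m) n) := by
  have h := chu_vandermonde n (n + 2 * a - 1) (2 * a + m) (by positivity)
  rw [show 2 * a + m - (n + 2 * a - 1) = (m : ℝ) + 1 - n by ring] at h
  rw [← h, jacobi, Finset.sum_mul, map_sum, Finset.mul_sum]
  refine Finset.sum_congr rfl fun k _ => ?_
  rw [mul_assoc, ← smul_eq_C_mul, map_smul, smul_eq_mul, mul_comm _ (X ^ m), hE, add_comm k m,
    poch_add]
  have := poch_pos ha k
  have := poch_pos (x := 2 * a) (by positivity) m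
  have := poch_pos (x := 2 * a + m) (by positivity) k
  field_simp

/-- Orthogonality to lower degrees forces g to be g(1) times `jacobi a n`, so only the norm of the
latter has to be computed. -/
theorem functional_sq_eq (ha : 1 / 2 ≤ a)
    (hE : ∀ k m, E (X ^ m * (1 - X) ^ k) = poch a k * poch a m / poch (2 * a) (k + m))
    {n : ℕ} {g : ℝ[X]} (hdeg : g.natDegree ≤ n) (hg : ∀ m < n, E (g * X ^ m) = 0) :
    E (g * g) = g.eval 1 ^ 2 *
      (n.factorial * poch (n + 2 * a - 1) n / poch (2 * a) (n + n)) := by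
  have ha' : 0 < a := by linarith
  have orth : ∀ n, ∀ m < n, E (jacobi a n * X ^ m) = 0 := fun n m h => by
    rw [functional_jacobi_mul_X_pow ha' hE, poch_eq_zero h]; simp
  have top : ∀ n : ℕ, E (jacobi a n * X ^ n) = poch a n * n.factorial / poch (2 * a) (n + n) := by
    intro n
    rw [functional_jacobi_mul_X_pow ha' hE, poch_add, add_sub_cancel_left, poch_one]
    have := poch_pos (x := 2 * a) (by positivity) n
    have := poch_pos (x := 2 * a + n) (by positivity) n
    field_simp
  have lead : 0 < (jacobi a n).coeff n := by
    rw [coeff_jacobi]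
    refine div_pos ?_ (poch_pos ha' n)
    rcases n with _ | n
    · simp
    · apply poch_pos; push_cast; have : (0 : ℝ) ≤ n := by positivity
      linarith
  set c := g.coeff n / (jacobi a n).coeff n with hc
  set r := g - C c * jacobi a n with hr
  have hrdeg : r.natDegree ≤ n :=
    (natDegree_sub_le_of_le hdeg ((natDegree_C_mul_le _ _).trans (natDegree_jacobi_le a n))).trans
      (max_self n).le
  have hrn : r.coeff n = 0 := by
    rw [hr, coeff_sub, coeff_C_mul, hc]; field_simp; ring
  have hrorth : ∀ m < n, E (r * X ^ m) = 0 := fun m hm => by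
    rw [hr, sub_mul, map_sub, hg m hm, mul_assoc, ← smul_eq_C_mul, map_smul, orth n m hm]; simp
  -- Positivity of E is not assumed. A nonzero remainder has degree below n; pairing it with the
  -- Jacobi polynomial of its own degree isolates its leading coefficient, which must vanish.
  have hr0 : r = 0 := by
    by_contra hne
    have hlt : r.natDegree < n := by
      refine lt_of_le_of_ne hrdeg fun h => hne ?_
      rw [← h] at hrn
      exact leadingCoeff_eq_zero.1 hrn
    have h1 := functional_mul_eq_zero hrorth
      (f := jacobi a r.natDegree) ((natDegree_jacobi_le _ _).trans_lt hlt)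
    rw [mul_comm, functional_mul_eq_coeff (orth _) le_rfl, top] at h1
    have := poch_pos ha' r.natDegree
    have := poch_pos (x := 2 * a) (by positivity) (r.natDegree + r.natDegree)
    have h2 : r.coeff r.natDegree = 0 := by
      rcases mul_eq_zero.1 h1 with h | h
      · exact h
      · exact absurd h (by positivity)
    exact hne (leadingCoeff_eq_zero.1 h2)
  have hgc : g = C c * jacobi a n := sub_eq_zero.1 hr0
  have hev : g.eval 1 = c := by rw [hgc]; simp [eval_one_jacobi]
  have hJJ : E (jacobi a n * jacobi a n) =
      n.factorial * poch (n + 2 * a - 1) n / poch (2 * a) (n + n) := by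
    rw [functional_mul_eq_coeff (orth n) (natDegree_jacobi_le a n), top, coeff_jacobi]
    have := poch_pos ha' n
    field_simp
  rw [← hJJ, hev, hgc, show C c * jacobi a n * (C c * jacobi a n) =
    C (c ^ 2) * (jacobi a n * jacobi a n) by rw [C_pow]; ring, ← smul_eq_C_mul, map_smul,
    smul_eq_mul]

end Functional

/-! ### Growth of the normalising constant -/

/-- Each ratio (b + j)/j = 1 + b/j is at most exp(b/j). -/
theorem poch_le_exp {b : ℝ} (hb : 0 ≤ b) (m : ℕ) :
    poch (b + 1) m ≤ m.factorial * Real.exp (b * harmonic m) := by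
  induction m with
  | zero => simp
  | succ m ih =>
    rw [poch_succ, harmonic_succ, Nat.factorial_succ]
    push_cast
    rw [mul_add b, Real.exp_add]
    have h := Real.add_one_le_exp (b * (m + 1 : ℝ)⁻¹)
    have hm : (0 : ℝ) < m + 1 := by positivity
    have e : b + 1 + m = (m + 1) * (b * (m + 1 : ℝ)⁻¹ + 1) := by field_simp; ring
    rw [e]
    calc poch (b + 1) m * ((m + 1) * (b * (m + 1 : ℝ)⁻¹ + 1))
        ≤ (m.factorial * Real.exp (b * harmonic m)) * ((m + 1) * Real.exp (b * (m + 1 : ℝ)⁻¹)) := by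
          gcongr
      _ = _ := by ring

/-- With b = 2λ this bounds g(1)²/E(g²). The block (n+b)⋯(2n-1+b) cancels exactly; what remains is
(b+1)⋯(b+n-1), of order (n-1)! n^b, and the last factor b + 2n, at most (b+2)n. -/
theorem poch_div_le {b : ℝ} (hb : 0 ≤ b) {n : ℕ} (hn : 1 ≤ n) :
    poch (b + 1) (n + n) ≤ ((b + 2) * Real.exp b * (n : ℝ) ^ b) *
      (n.factorial * poch (n + b) n) := by
  obtain ⟨m, rfl⟩ : ∃ m, n = m + 1 := ⟨n - 1, by omega⟩
  have h1 := poch_le_exp hb m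
  have h2 : (harmonic m : ℝ) ≤ 1 + Real.log ((m + 1 : ℕ) : ℝ) := by
    refine le_trans ?_ (harmonic_le_one_add_log (m + 1))
    rw [harmonic_succ]; push_cast
    have : (0 : ℝ) ≤ (m + 1 : ℝ)⁻¹ := by positivity
    linarith
  have h3 : Real.exp (b * harmonic m) ≤ Real.exp b * ((m + 1 : ℕ) : ℝ) ^ b := by
    rw [Real.rpow_def_of_pos (by positivity), ← Real.exp_add]
    apply Real.exp_le_exp.2
    nlinarith
  have e : poch (b + 1) (m + 1 + (m + 1)) =
      poch (b + 1) m * poch ((m + 1 : ℕ) + b) (m + 1) * (b + 2 * (m + 1)) := by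
    rw [show m + 1 + (m + 1) = m + (m + 1) + 1 by ring, poch_succ, poch_add]
    push_cast
    rw [show b + 1 + m = (m : ℝ) + 1 + b by ring]
    ring
  have hp : 0 < poch ((m + 1 : ℕ) + b) (m + 1) := poch_pos (by positivity) _
  rw [e, Nat.factorial_succ]
  have h4 : b + 2 * (m + 1 : ℝ) ≤ (b + 2) * (m + 1) := by nlinarith [(Nat.cast_nonneg m : (0 : ℝ) ≤ m)]
  calc _ ≤ (m.factorial * (Real.exp b * ((m + 1 : ℕ) : ℝ) ^ b)) * poch ((m + 1 : ℕ) + b) (m + 1) *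
        ((b + 2) * (m + 1)) := by
        gcongr
        exact h1.trans (by gcongr)
    _ = _ := by push_cast; ring

/-! ### The one-variable bound for the Gegenbauer weight -/

/-- The functional `E` has the moments of the Gegenbauer weight `(1 - s²)^(λ - 1/2)`. -/
structure IsGegenbauer (E : ℝ[X] →ₗ[ℝ] ℝ) (lam : ℝ) : Prop where
  even : ∀ i, E (X ^ (2 * i)) = poch (1 / 2) i / poch (lam + 1) i
  odd : ∀ i, E (X ^ (2 * i + 1)) = 0

namespace IsGegenbauer

variable {E : ℝ[X] →ₗ[ℝ] ℝ} {lam : ℝ}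

/-- This is integration by parts: the derivative of (1-x²)^(λ+1/2) f integrates to zero. It is
derived from the moments alone, so it serves any functional having them. -/
theorem pearson (hE : IsGegenbauer E lam) (hlam : 0 ≤ lam) (f : ℝ[X]) :
    E ((1 - X ^ 2) * derivative f - C (2 * lam + 1) * (X * f)) = 0 := by
  induction f using Polynomial.induction_on' with
  | add p q hp hq =>
    rw [← add_zero (0 : ℝ)]
    nth_rewrite 1 [← hp]
    rw [← hq, ← map_add, derivative_add]
    congr 1
    ring
  | monomial k c =>
    rw [← C_mul_X_pow_eq_monomial, derivative_C_mul,
      show (1 - X ^ 2) * (C c * derivative (X ^ k)) - C (2 * lam + 1) * (X * (C c * X ^ k)) =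
        C c * ((1 - X ^ 2) * derivative (X ^ k) - C (2 * lam + 1) * X ^ (k + 1)) by ring,
      ← smul_eq_C_mul, map_smul]
    suffices h : E ((1 - X ^ 2) * derivative (X ^ k) - C (2 * lam + 1) * X ^ (k + 1)) = 0 by
      rw [h, smul_zero]
    rcases k with _ | k
    · have := hE.odd 0
      simp only [mul_zero, zero_add, pow_one] at this
      rw [pow_zero, derivative_one, mul_zero, zero_sub, zero_add, pow_one, map_neg,
        ← smul_eq_C_mul, map_smul, this, smul_zero, neg_zero]
    · rw [derivative_X_pow, Nat.add_sub_cancel,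
        show (1 - X ^ 2) * (C ((k + 1 : ℕ) : ℝ) * X ^ k) - C (2 * lam + 1) * X ^ (k + 1 + 1) =
          C ((k + 1 : ℕ) : ℝ) * X ^ k -
            (C ((k + 1 : ℕ) : ℝ) + C (2 * lam + 1)) * X ^ (k + 2) by ring,
        ← C_add, ← smul_eq_C_mul, ← smul_eq_C_mul, map_sub, map_smul, map_smul]
      obtain ⟨i, rfl | rfl⟩ := Nat.even_or_odd' k
      · rw [show 2 * i + 2 = 2 * (i + 1) by ring, hE.even, hE.even, poch_succ, poch_succ]
        have := poch_pos (x := lam + 1) (by positivity) i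
        have : 0 < lam + 1 + i := by positivity
        push_cast
        simp only [smul_eq_mul]
        field_simp
        ring
      · rw [show 2 * i + 1 + 2 = 2 * (i + 1) + 1 by ring, hE.odd, hE.odd]; simp

/-- With u = (1+X)/2 and v = (1-X)/2, `pearson` for u^m v^k relates the moments of u^(m+1) v^k and
u^m v^(k+1), and u + v = 1 gives their sum. Together they determine both from the moment of u^m v^k.
-/
theorem beta_moments (hE : IsGegenbauer E lam) (hlam : 0 ≤ lam) (k m : ℕ) :
    E ((C (1 / 2) * (1 + X)) ^ m * (C (1 / 2) * (1 - X)) ^ k) =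
      poch (lam + 1 / 2) k * poch (lam + 1 / 2) m / poch (2 * (lam + 1 / 2)) (k + m) := by
  obtain ⟨u, hu⟩ : ∃ u : ℝ[X], u = C (1 / 2) * (1 + X) := ⟨_, rfl⟩
  obtain ⟨v, hv⟩ : ∃ v : ℝ[X], v = C (1 / 2) * (1 - X) := ⟨_, rfl⟩
  obtain ⟨a, ha⟩ : ∃ a : ℝ, a = lam + 1 / 2 := ⟨_, rfl⟩
  rw [← hu, ← hv, ← ha]
  have hC : (C (1 / 2) : ℝ[X]) * 2 = 1 := by
    rw [← map_ofNat C 2, ← C_mul]; norm_num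
  have huv : u + v = 1 := by rw [hu, hv]; linear_combination hC
  have huX : u - v = X := by rw [hu, hv]; linear_combination X * hC
  have du : derivative u = C (1 / 2) := by simp [hu]
  have dv : derivative v = - C (1 / 2) := by simp [hv]
  have hsq : (1 - X ^ 2 : ℝ[X]) = 4 * (u * v) := by
    rw [← huX]; linear_combination (-(1 + u + v)) * huv
  have step (k m : ℕ) : (k + a) * E (u ^ (m + 1) * v ^ k) = (m + a) * E (u ^ m * v ^ (k + 1)) := by
    have hp := hE.pearson hlam (u ^ m * v ^ k)
    have e1 : (u * v) * derivative (u ^ m * v ^ k) =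
        C (1 / 2) * (C (m : ℝ) * (u ^ m * v ^ (k + 1)) - C (k : ℝ) * (u ^ (m + 1) * v ^ k)) := by
      rw [derivative_mul, derivative_pow, derivative_pow, du, dv]
      rcases m with _ | m <;> rcases k with _ | k <;> simp <;> ring
    have e2 : (1 - X ^ 2) * derivative (u ^ m * v ^ k) - C (2 * lam + 1) * (X * (u ^ m * v ^ k)) =
        C (2 : ℝ) * (C (m + a) * (u ^ m * v ^ (k + 1)) - C (k + a) * (u ^ (m + 1) * v ^ k)) := by
      rw [hsq, mul_assoc, e1, show 2 * lam + 1 = 2 * a by rw [ha]; ring]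
      nth_rewrite 1 [← huX]
      simp only [C_add, C_mul, show (C (2 : ℝ) : ℝ[X]) = 2 from map_ofNat C 2]
      linear_combination
        2 * (C (m : ℝ) * (u ^ m * v ^ (k + 1)) - C (k : ℝ) * (u ^ (m + 1) * v ^ k)) * hC
    rw [e2, ← smul_eq_C_mul, map_smul, map_sub, ← smul_eq_C_mul, ← smul_eq_C_mul, map_smul,
      map_smul] at hp
    simp only [smul_eq_mul] at hp
    linarith
  have split (k m : ℕ) :
      E (u ^ (m + 1) * v ^ k) + E (u ^ m * v ^ (k + 1)) = E (u ^ m * v ^ k) := by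
    rw [← map_add]; congr 1; linear_combination (u ^ m * v ^ k) * huv
  have ha0 : 0 < a := by rw [ha]; positivity
  have stepk (k m : ℕ) :
      E (u ^ m * v ^ (k + 1)) = (k + a) / (2 * a + (k + m : ℕ)) * E (u ^ m * v ^ k) := by
    have : 0 < 2 * a + (k + m : ℕ) := by positivity
    rw [← split k m, div_mul_eq_mul_div, eq_div_iff this.ne']
    push_cast
    linear_combination -(step k m)
  have stepm (k m : ℕ) :
      E (u ^ (m + 1) * v ^ k) = (m + a) / (2 * a + (k + m : ℕ)) * E (u ^ m * v ^ k) := by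
    have : 0 < 2 * a + (k + m : ℕ) := by positivity
    rw [← split k m, div_mul_eq_mul_div, eq_div_iff this.ne']
    push_cast
    linear_combination (step k m)
  induction m with
  | zero =>
    induction k with
    | zero => have := hE.even 0; simpa using this
    | succ k ih =>
      rw [stepk, ih, add_zero, add_zero, poch_succ (2 * a), poch_succ a]
      have := poch_pos (x := 2 * a) (by positivity) k
      have : 0 < 2 * a + (k : ℕ) := by positivity
      field_simp
      ring
  | succ m ih =>
    rw [stepm, ih, ← add_assoc, poch_succ (2 * a), poch_succ a]
    have := poch_pos (x := 2 * a) (by positivity) (k + m)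
    have : 0 < 2 * a + (k + m : ℕ) := by positivity
    field_simp
    ring

/-- A polynomial of degree at most `n` that is orthogonal to all polynomials of smaller degree
for the Gegenbauer weight is bounded at `1` by its norm times `n ^ λ`, up to a constant. -/
theorem eval_one_sq_le (hE : IsGegenbauer E lam) (hlam : 0 ≤ lam) {n : ℕ} (hn : 1 ≤ n) {g : ℝ[X]}
    (hdeg : g.natDegree ≤ n) (hg : ∀ m < n, E (g * X ^ m) = 0) :
    g.eval 1 ^ 2 ≤ (2 * lam + 2) * Real.exp (2 * lam) * (n : ℝ) ^ (2 * lam) * E (g * g) := by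
  -- φ maps [-1, 1] onto [0, 1], ψ is its inverse, and both fix 1, so evaluation at 1 is unaffected
  -- by the change of variable.
  set φ : ℝ[X] := C (1 / 2) * (1 + X) with hφ
  set ψ : ℝ[X] := C 2 * X - 1 with hψ
  have hC : (C (1 / 2) : ℝ[X]) * 2 = 1 := by
    rw [← map_ofNat C 2, ← C_mul]; norm_num
  have hψφ : aeval φ ψ = X := by
    simp only [hψ, hφ, map_sub, map_mul, aeval_C, aeval_X, map_one]
    rw [algebraMap_eq, show (C 2 : ℝ[X]) = 2 from map_ofNat C 2]
    linear_combination (1 + X) * hC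
  have hcomp : ∀ f : ℝ[X], aeval φ (aeval ψ f) = f := fun f => by
    rw [← aeval_algHom_apply, hψφ, aeval_X_left_apply]
  set E' : ℝ[X] →ₗ[ℝ] ℝ := E ∘ₗ (aeval φ).toLinearMap with hE'
  have hE'X : ∀ k m, E' (X ^ m * (1 - X) ^ k) =
      poch (lam + 1 / 2) k * poch (lam + 1 / 2) m / poch (2 * (lam + 1 / 2)) (k + m) := by
    intro k m
    rw [← hE.beta_moments hlam]
    simp only [hE', LinearMap.comp_apply, AlgHom.toLinearMap_apply, map_mul, map_pow, map_sub,
      aeval_X, map_one]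
    congr 3
    rw [hφ]
    linear_combination -hC
  have hdeg' : (aeval ψ g).natDegree ≤ n := by
    rw [← comp_eq_aeval]
    refine natDegree_comp_le.trans ?_
    have : ψ.natDegree ≤ 1 := by rw [hψ]; compute_degree
    nlinarith
  have horth : ∀ m < n, E' (aeval ψ g * X ^ m) = 0 := by
    intro m hm
    simp only [hE', LinearMap.comp_apply, AlgHom.toLinearMap_apply, map_mul, map_pow, aeval_X,
      hcomp]
    refine functional_mul_eq_zero hg (lt_of_le_of_lt ?_ hm)
    rw [hφ]
    compute_degree
  have hev : (aeval ψ g).eval 1 = g.eval 1 := by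
    rw [← comp_eq_aeval, eval_comp, hψ]; norm_num
  have h := functional_sq_eq (by linarith) hE'X hdeg' horth
  have hEE : E' (aeval ψ g * aeval ψ g) = E (g * g) := by
    simp only [hE', LinearMap.comp_apply, AlgHom.toLinearMap_apply, map_mul, hcomp]
  rw [hEE, hev, show 2 * (lam + 1 / 2) = 2 * lam + 1 by ring,
    show (n : ℝ) + (2 * lam + 1) - 1 = n + 2 * lam by ring] at h
  have hb := poch_div_le (b := 2 * lam) (by positivity) hn
  rw [h]
  have hp : 0 < poch (2 * lam + 1) (n + n) := poch_pos (by positivity) _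
  rw [mul_left_comm, ← mul_div_assoc]
  refine le_mul_of_one_le_right (sq_nonneg _) ?_
  rwa [one_le_div hp]

end IsGegenbauer

end

end BallPoly

/-! ### Moments of the weight on the ball -/

namespace BallPoly

noncomputable section

open Set Real

theorem Gamma_add_nat {x : ℝ} (hx : 0 < x) (n : ℕ) : Gamma (x + n) = poch x n * Gamma x := by
  induction n with
  | zero => simp
  | succ n ih =>
    rw [poch_succ, Nat.cast_succ, ← add_assoc, Gamma_add_one (by positivity), ih]; ring

theorem integral_beta {α β : ℝ} (hα : 0 < α) (hβ : 0 < β) :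
    ∫ u in Ioo (0 : ℝ) 1, u ^ (α - 1) * (1 - u) ^ (β - 1) =
      Gamma α * Gamma β / Gamma (α + β) := by
  have h := ProbabilityTheory.beta_eq_betaIntegralReal α β hα hβ
  rw [ProbabilityTheory.beta] at h
  rw [h, Complex.betaIntegral, intervalIntegral.integral_of_le zero_le_one,
    ← integral_Ioc_eq_integral_Ioo]
  have e : ∫ x in Ioc (0 : ℝ) 1, (x : ℂ) ^ ((α : ℂ) - 1) * (1 - (x : ℂ)) ^ ((β : ℂ) - 1) =
      ∫ x in Ioc (0 : ℝ) 1, ((x ^ (α - 1) * (1 - x) ^ (β - 1) : ℝ) : ℂ) := by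
    refine setIntegral_congr_fun measurableSet_Ioc fun x hx => ?_
    rw [Complex.ofReal_mul, Complex.ofReal_cpow hx.1.le, Complex.ofReal_cpow (by linarith [hx.2])]
    push_cast
    rfl
  rw [e, integral_complex_ofReal, Complex.ofReal_re]

theorem integral_radial_weight {d i j : ℕ} (hd : 1 ≤ d) {κ : ℝ} (hκ : -(1 / 2) < κ) :
    ∫ r in Ioi (0 : ℝ), r ^ (d - 1) * (r ^ (2 * i) *
      ((1 - r ^ 2) ^ j * if r ≤ 1 then (1 - r ^ 2) ^ (κ - 1 / 2) else 0)) =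
      1 / 2 * (Gamma (d / 2 + i) * Gamma (κ + 1 / 2 + j) / Gamma (κ + 1 / 2 + d / 2 + (i + j : ℕ))) := by
  have hd' : (1 : ℝ) ≤ d := by exact_mod_cast hd
  have hb := integral_beta (α := d / 2 + i) (β := κ + 1 / 2 + j) (by positivity)
    (by have : (0 : ℝ) ≤ j := by positivity
        linarith)
  rw [show (d / 2 + i : ℝ) + (κ + 1 / 2 + j) = κ + 1 / 2 + d / 2 + (i + j : ℕ) by
    push_cast; ring] at hb
  have hind : ∀ x ∉ Ioi (0 : ℝ), (Ioo (0 : ℝ) 1).indicator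
      (fun u => u ^ ((d : ℝ) / 2 + i - 1) * (1 - u) ^ (κ + 1 / 2 + j - 1)) x = 0 := fun x hx =>
    indicator_of_notMem (fun h => hx h.1) _
  have hc := integral_comp_rpow_Ioi_of_pos (p := 2) two_pos (g := (Ioo (0 : ℝ) 1).indicator
      (fun u => u ^ ((d : ℝ) / 2 + i - 1) * (1 - u) ^ (κ + 1 / 2 + j - 1)))
  rw [← hb, ← integral_indicator measurableSet_Ioo,
    ← setIntegral_eq_integral_of_forall_compl_eq_zero hind, ← hc, ← integral_const_mul]
  -- After the substitution u = r² the beta integral lives on the open interval, while the weight is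
  -- cut off at r ≤ 1; the endpoint is a null set.
  have hne : ∀ᵐ r ∂(volume.restrict (Ioi (0 : ℝ))), r ≠ 1 :=
    ae_restrict_of_ae (by simp [ae_iff])
  refine integral_congr_ae ?_
  filter_upwards [hne, ae_restrict_mem measurableSet_Ioi] with r hr1 hr0
  have hr0 : 0 < r := hr0
  rw [rpow_two]
  by_cases h : r ≤ 1
  · have hlt : r < 1 := lt_of_le_of_ne h hr1
    have h2 : 0 < 1 - r ^ 2 := by nlinarith
    rw [if_pos h, indicator_of_mem (by constructor <;> nlinarith)]
    rw [show κ + 1 / 2 + j - 1 = (j : ℝ) + (κ - 1 / 2) by ring, rpow_add h2, rpow_natCast,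
      ← rpow_two r, ← rpow_mul hr0.le, smul_eq_mul]
    have : r ^ (2 * ((d : ℝ) / 2 + i - 1)) * r ^ ((2 : ℝ) - 1) = r ^ (d - 1) * r ^ (2 * i) := by
      rw [← rpow_add hr0, ← pow_add, ← rpow_natCast]
      congr 1
      rw [Nat.cast_add, Nat.cast_sub hd]; push_cast; ring
    linear_combination -((1 - r ^ (2 : ℝ)) ^ j * (1 - r ^ (2 : ℝ)) ^ (κ - 1 / 2)) * this
  · rw [if_neg h, indicator_of_notMem]
    · simp
    · simp only [mem_Ioo, not_and, not_lt]; intro; nlinarith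

theorem integral_radial_gaussian {d i : ℕ} (hd : 1 ≤ d) :
    ∫ r in Ioi (0 : ℝ), r ^ (d - 1) * (r ^ (2 * i) * exp (-r ^ 2)) = 1 / 2 * Gamma (d / 2 + i) := by
  have h := integral_rpow_mul_exp_neg_rpow (p := 2) (q := ((d - 1 + 2 * i : ℕ) : ℝ)) two_pos
    (by have : (0 : ℝ) ≤ ((d - 1 + 2 * i : ℕ) : ℝ) := by positivity
        linarith)
  rw [show (((d - 1 + 2 * i : ℕ) : ℝ) + 1) / 2 = d / 2 + i by
    rw [Nat.cast_add, Nat.cast_sub hd]; push_cast; ring] at h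
  rw [← h]
  refine setIntegral_congr_fun measurableSet_Ioi fun r _ => ?_
  simp only [rpow_natCast, rpow_two, pow_add]
  ring

/-- Integration in polar coordinates of a power of a linear form times a radial function. -/
theorem integral_inner_pow_mul_norm {d : ℕ} (hd : 1 ≤ d) (a : EuclideanSpace ℝ (Fin d)) (m : ℕ)
    (f : ℝ → ℝ) :
    ∫ y : EuclideanSpace ℝ (Fin d), inner ℝ a y ^ m * f ‖y‖ =
      (∫ ω, inner ℝ a (ω : EuclideanSpace ℝ (Fin d)) ^ m
        ∂(volume : Measure (EuclideanSpace ℝ (Fin d))).toSphere) *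
        ∫ r in Ioi (0 : ℝ), r ^ (d - 1) * (r ^ m * f r) := by
  set μ : Measure (EuclideanSpace ℝ (Fin d)) := volume
  have : Nonempty (Fin d) := ⟨⟨0, hd⟩⟩
  calc ∫ y, inner ℝ a y ^ m * f ‖y‖ ∂μ
      = ∫ y : ({0}ᶜ : Set (EuclideanSpace ℝ (Fin d))), inner ℝ a y.1 ^ m * f ‖y.1‖
          ∂(μ.comap (↑)) := by
        rw [integral_subtype_comap (measurableSet_singleton _).compl
          fun y => inner ℝ a y ^ m * f ‖y‖, restrict_compl_singleton]
    _ = ∫ x, inner ℝ a (x.1 : EuclideanSpace ℝ (Fin d)) ^ m * ((x.2 : ℝ) ^ m * f x.2)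
          ∂μ.toSphere.prod (.volumeIoiPow (d - 1)) := by
        have h := μ.measurePreserving_homeomorphUnitSphereProd.integral_comp
          (Homeomorph.measurableEmbedding _)
          (fun x => inner ℝ a (x.1 : EuclideanSpace ℝ (Fin d)) ^ m * ((x.2 : ℝ) ^ m * f x.2))
        rw [finrank_euclideanSpace_fin] at h
        rw [← h]
        refine integral_congr_ae (.of_forall fun y => ?_)
        have hy : ‖y.1‖ ≠ 0 := norm_ne_zero_iff.2 y.2
        simp only [homeomorphUnitSphereProd_apply_fst_coe, homeomorphUnitSphereProd_apply_snd_coe,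
          inner_smul_right]
        rw [← mul_assoc, ← mul_pow, mul_right_comm, inv_mul_cancel₀ hy, one_mul]
    _ = _ := by
        rw [integral_prod_mul (fun ω : Metric.sphere (0 : EuclideanSpace ℝ (Fin d)) 1 =>
          inner ℝ a (ω : EuclideanSpace ℝ (Fin d)) ^ m) (fun r : Ioi (0 : ℝ) => (r : ℝ) ^ m * f r)]
        congr 1
        simp only [Measure.volumeIoiPow, ENNReal.ofReal]
        rw [integral_withDensity_eq_integral_smul,
          integral_subtype_comap measurableSet_Ioi
            fun r : ℝ => Real.toNNReal (r ^ (d - 1)) • (r ^ m * f r)]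
        · refine setIntegral_congr_fun measurableSet_Ioi fun r hr => ?_
          simp only [NNReal.smul_def, smul_eq_mul]
          rw [Real.coe_toNNReal _ (pow_nonneg (le_of_lt hr) _)]
        · exact (measurable_subtype_coe.pow_const _).real_toNNReal

theorem integral_even_pow_mul_exp (i : ℕ) :
    ∫ x : ℝ, x ^ (2 * i) * exp (-x ^ 2) = Gamma (1 / 2 + i) := by
  have h := integral_comp_abs (f := fun x : ℝ => x ^ (2 * i) * exp (-x ^ 2))
  simp only [sq_abs, pow_mul] at h
  simp only [pow_mul]
  rw [h]
  have h2 := integral_radial_gaussian (d := 1) (i := i) le_rfl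
  simp only [Nat.sub_self, pow_zero, one_mul, pow_mul, Nat.cast_one] at h2
  rw [h2]; ring

/-- A reflection turns a into a multiple of a coordinate vector, and the Gaussian integral then
factors over the coordinates. -/
theorem integral_inner_pow_mul_exp {d : ℕ} (hd : 1 ≤ d) (a : EuclideanSpace ℝ (Fin d)) (i : ℕ) :
    ∫ y : EuclideanSpace ℝ (Fin d), inner ℝ a y ^ (2 * i) * exp (-‖y‖ ^ 2) =
      ‖a‖ ^ (2 * i) * (poch (1 / 2) i * Gamma (1 / 2) ^ d) := by
  set e : EuclideanSpace ℝ (Fin d) := EuclideanSpace.single ⟨0, hd⟩ ‖a‖ with he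
  have hn : ‖e‖ = ‖a‖ := by simp [he]
  set R := (Submodule.span ℝ {e - a})ᗮ.reflection with hR
  have hRe : R e = a := Submodule.reflection_sub hn
  rw [← R.measurePreserving.integral_comp R.toHomeomorph.measurableEmbedding]
  simp only [LinearIsometryEquiv.norm_map]
  have h1 : ∀ y, inner ℝ a (R y) = ‖a‖ * y ⟨0, hd⟩ := fun y => by
    nth_rewrite 1 [← hRe]
    rw [LinearIsometryEquiv.inner_map_map, he, EuclideanSpace.inner_single_left]; simp
  simp only [h1, mul_pow, mul_assoc]
  rw [integral_const_mul]
  congr 1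
  rw [← (PiLp.volume_preserving_toLp (Fin d)).integral_comp
    (MeasurableEquiv.toLp 2 (Fin d → ℝ)).measurableEmbedding]
  have h2 : ∀ x : Fin d → ℝ, (WithLp.toLp 2 x : EuclideanSpace ℝ (Fin d)) ⟨0, hd⟩ ^ (2 * i) *
      exp (-‖(WithLp.toLp 2 x : EuclideanSpace ℝ (Fin d))‖ ^ 2) =
      ∏ k, (if k = ⟨0, hd⟩ then x k ^ (2 * i) else 1) * exp (-x k ^ 2) := by
    intro x
    rw [Finset.prod_mul_distrib, ← Real.exp_sum, EuclideanSpace.real_norm_sq_eq]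
    simp
  simp only [h2]
  rw [integral_fintype_prod_volume_eq_prod
    (fun (k : Fin d) (t : ℝ) => (if k = ⟨0, hd⟩ then t ^ (2 * i) else 1) * exp (-t ^ 2))]
  have h3 : ∀ k : Fin d, ∫ t : ℝ, (if k = ⟨0, hd⟩ then t ^ (2 * i) else 1) * exp (-t ^ 2) =
      (if k = ⟨0, hd⟩ then poch (1 / 2) i else 1) * Gamma (1 / 2) := by
    intro k
    split_ifs
    · rw [integral_even_pow_mul_exp, Gamma_add_nat (by norm_num)]
    · have := integral_even_pow_mul_exp 0
      simpa using this
  simp only [h3, Finset.prod_mul_distrib]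
  simp

theorem integral_weightMeasure {d : ℕ} {κ : ℝ} (f : EuclideanSpace ℝ (Fin d) → ℝ) :
    ∫ y, f y ∂(weightMeasure d κ) =
      ∫ y, f y * if ‖y‖ ≤ 1 then (1 - ‖y‖ ^ 2) ^ (κ - 1 / 2) else 0 := by
  rw [weightMeasure, integral_withDensity_eq_integral_toReal_smul (by fun_prop) (by simp),
    ← integral_indicator Metric.isClosed_closedBall.measurableSet]
  refine integral_congr_ae (.of_forall fun y => ?_)
  simp only [indicator, mem_closedBall_zero_iff]
  split_ifs with h
  · rw [ENNReal.toReal_ofReal (rpow_nonneg (by nlinarith [norm_nonneg y]) _), smul_eq_mul, mul_comm]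
  · simp

/-- The unnormalized moments of the weight on the ball. -/
theorem integral_weightMeasure_inner_pow {d : ℕ} (hd : 1 ≤ d) {κ : ℝ} (hκ : -(1 / 2) < κ)
    (a : EuclideanSpace ℝ (Fin d)) (i j : ℕ) :
    ∫ y, inner ℝ a y ^ (2 * i) * (1 - ‖y‖ ^ 2) ^ j ∂(weightMeasure d κ) =
      ‖a‖ ^ (2 * i) * (poch (1 / 2) i * poch (κ + 1 / 2) j / poch (κ + 1 / 2 + d / 2) (i + j)) *
        (Gamma (1 / 2) ^ d * Gamma (κ + 1 / 2) / Gamma (κ + 1 / 2 + d / 2)) := by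
  have hd' : (1 : ℝ) ≤ d := by exact_mod_cast hd
  have hκ' : 0 < κ + 1 / 2 := by linarith
  -- The Gaussian and the ball weight share the same spherical integral in polar coordinates; the
  -- Gaussian case, known in closed form, supplies its value.
  have h1 := integral_inner_pow_mul_norm hd a (2 * i) (fun r => exp (-r ^ 2))
  rw [integral_inner_pow_mul_exp hd, integral_radial_gaussian hd] at h1
  rw [integral_weightMeasure]
  simp only [mul_assoc]
  rw [integral_inner_pow_mul_norm hd a (2 * i)
    (fun r => (1 - r ^ 2) ^ j * if r ≤ 1 then (1 - r ^ 2) ^ (κ - 1 / 2) else 0),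
    integral_radial_weight hd hκ]
  rw [Gamma_add_nat hκ', Gamma_add_nat (by positivity : 0 < κ + 1 / 2 + d / 2)]
  linear_combination -(poch (κ + 1 / 2) j * Gamma (κ + 1 / 2) /
    (poch (κ + 1 / 2 + d / 2) (i + j) * Gamma (κ + 1 / 2 + d / 2))) * h1

theorem integral_F {d : ℕ} {κ : ℝ} (f : EuclideanSpace ℝ (Fin d) → ℝ) :
    ∫ y, f y ∂(F d κ) = (∫ _, (1 : ℝ) ∂(weightMeasure d κ))⁻¹ * ∫ y, f y ∂(weightMeasure d κ) := by
  rw [F, integral_smul_measure]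
  simp [Measure.real]

/-- The moments of `F_κ`. -/
theorem integral_F_inner_pow {d : ℕ} (hd : 1 ≤ d) {κ : ℝ} (hκ : -(1 / 2) < κ)
    (a : EuclideanSpace ℝ (Fin d)) (i j : ℕ) :
    ∫ y, inner ℝ a y ^ (2 * i) * (1 - ‖y‖ ^ 2) ^ j ∂(F d κ) =
      ‖a‖ ^ (2 * i) * (poch (1 / 2) i * poch (κ + 1 / 2) j / poch (κ + 1 / 2 + d / 2) (i + j)) := by
  have h0 := integral_weightMeasure_inner_pow hd hκ a 0 0
  simp only [mul_zero, pow_zero, mul_one, poch_zero, one_mul, add_zero, div_one] at h0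
  have hκ' : 0 < κ + 1 / 2 := by linarith
  have g1 : 0 < Gamma (κ + 1 / 2 + d / 2) := Gamma_pos_of_pos (by positivity)
  have g2 : 0 < Gamma (κ + 1 / 2) := Gamma_pos_of_pos hκ'
  have g3 : 0 < Gamma (1 / 2 : ℝ) := Gamma_pos_of_pos (by positivity)
  rw [integral_F, integral_weightMeasure_inner_pow hd hκ, h0, mul_comm, mul_assoc,
    mul_inv_cancel₀ (by positivity), mul_one]

theorem integral_F_inner_pow_odd {d : ℕ} {κ : ℝ} (a : EuclideanSpace ℝ (Fin d)) (i j : ℕ) :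
    ∫ y, inner ℝ a y ^ (2 * i + 1) * (1 - ‖y‖ ^ 2) ^ j ∂(F d κ) = 0 := by
  rw [integral_F, integral_weightMeasure
    (fun y : EuclideanSpace ℝ (Fin d) => inner ℝ a y ^ (2 * i + 1) * (1 - ‖y‖ ^ 2) ^ j)]
  have h := integral_neg_eq_self (fun y : EuclideanSpace ℝ (Fin d) =>
    inner ℝ a y ^ (2 * i + 1) * (1 - ‖y‖ ^ 2) ^ j *
      if ‖y‖ ≤ 1 then (1 - ‖y‖ ^ 2) ^ (κ - 1 / 2) else 0) volume
  simp only [inner_neg_right, norm_neg, Odd.neg_pow (odd_two_mul_add_one i), neg_mul,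
    integral_neg] at h
  rw [self_eq_neg.1 h.symm, mul_zero]

theorem isProbabilityMeasure_F {d : ℕ} (hd : 1 ≤ d) {κ : ℝ} (hκ : -(1 / 2) < κ) :
    IsProbabilityMeasure (F d κ) := by
  have h := integral_F_inner_pow hd hκ 0 0 0
  simp only [mul_zero, pow_zero, mul_one, poch_zero, add_zero, div_one, integral_const,
    smul_eq_mul, Measure.real] at h
  exact ⟨(ENNReal.toReal_eq_one_iff _).1 h⟩

end

end BallPoly

/-! ### Lifting the ball to one more dimension -/

namespace BallPoly

noncomputable section

open Set Real

/-- The moments of the probability density proportional to `(1 - t²)^(c - 3/2)` on `[-1, 1]`. -/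
def gmom (c : ℝ) (l : ℕ) : ℝ := if Even l then poch (1 / 2) (l / 2) / poch c (l / 2) else 0

@[simp] theorem gmom_two_mul (c : ℝ) (i : ℕ) : gmom c (2 * i) = poch (1 / 2) i / poch c i := by
  simp [gmom]

@[simp] theorem gmom_two_mul_add_one (c : ℝ) (i : ℕ) : gmom c (2 * i + 1) = 0 := by
  simp [gmom]

/-- A probability measure on `[-1, 1]` with the moments `gmom c`. -/
structure IsBetaLaw (m : Measure ℝ) (c : ℝ) : Prop where
  prob : IsProbabilityMeasure m
  ae_abs_le : ∀ᵐ t ∂m, |t| ≤ 1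
  moment : ∀ l, ∫ t, t ^ l ∂m = gmom c l

theorem inner_single_one (y : EuclideanSpace ℝ (Fin 1)) (s : ℝ) :
    inner ℝ (EuclideanSpace.single 0 s) y = s * y 0 := by
  simp [EuclideanSpace.inner_single_left]

theorem integral_F_one_pow {κ : ℝ} (hκ : -(1 / 2) < κ) (l : ℕ) :
    ∫ y, y 0 ^ l ∂(F 1 κ) = gmom (κ + 1) l := by
  have e : ∀ l : ℕ, ∫ y, y 0 ^ l ∂(F 1 κ) =
      ∫ y, inner ℝ (EuclideanSpace.single 0 1 : EuclideanSpace ℝ (Fin 1)) y ^ l *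
        (1 - ‖y‖ ^ 2) ^ 0 ∂(F 1 κ) := fun l => by
    simp only [inner_single_one, one_mul, pow_zero, mul_one]
  rw [e]
  obtain ⟨i, rfl | rfl⟩ := Nat.even_or_odd' l
  · rw [integral_F_inner_pow le_rfl hκ, gmom_two_mul]
    simp [show κ + 2⁻¹ + 2⁻¹ = κ + 1 by ring]
  · rw [integral_F_inner_pow_odd, gmom_two_mul_add_one]

/-- For c > 1/2 the law is `F 1 (c - 1)`. At c = 1/2, needed for ν = 0, the density is not
integrable and the law degenerates to a random sign. -/
theorem exists_isBetaLaw {c : ℝ} (hc : 1 / 2 ≤ c) : ∃ m, IsBetaLaw m c := by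
  rcases hc.eq_or_lt with rfl | hc
  · refine ⟨(2⁻¹ : ENNReal) • (Measure.dirac 1 + Measure.dirac (-1)), ⟨⟨?_⟩, ?_, ?_⟩⟩
    · simp only [Measure.smul_apply, Measure.add_apply, measure_univ, smul_eq_mul]
      rw [one_add_one_eq_two, ENNReal.inv_mul_cancel two_ne_zero ENNReal.ofNat_ne_top]
    · refine Measure.ae_smul_measure ?_ _
      rw [ae_add_measure_iff]
      simp [ae_dirac_eq]
    · intro l
      rw [integral_smul_measure, integral_add_measure (by simp [integrable_dirac])
        (by simp [integrable_dirac])]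
      simp only [integral_dirac, one_pow, ENNReal.toReal_inv, ENNReal.toReal_ofNat, smul_eq_mul]
      obtain ⟨i, rfl | rfl⟩ := Nat.even_or_odd' l
      · rw [gmom_two_mul, div_self (poch_pos (by norm_num) i).ne', pow_mul]; norm_num
      · rw [gmom_two_mul_add_one, Odd.neg_pow (odd_two_mul_add_one i)]; norm_num
  · have hκ : -(1 / 2) < c - 1 := by linarith
    have hmeas : Measurable fun y : EuclideanSpace ℝ (Fin 1) => y 0 := by fun_prop
    have := isProbabilityMeasure_F le_rfl hκ
    refine ⟨(F 1 (c - 1)).map fun y => y 0,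
      ⟨Measure.isProbabilityMeasure_map hmeas.aemeasurable, ?_, fun l => ?_⟩⟩
    · rw [ae_map_iff hmeas.aemeasurable (measurableSet_le (by fun_prop) (by fun_prop))]
      filter_upwards [ae_mem_unitBall 1 (c - 1)] with y hy
      exact (PiLp.norm_apply_le y 0).trans (by simpa using hy)
    · rw [integral_map hmeas.aemeasurable (by fun_prop), integral_F_one_pow hκ]
      simp

section Lift

variable {d : ℕ} {ν c : ℝ} {m : Measure ℝ}

theorem IsBetaLaw.integrable_of_continuous (hm : IsBetaLaw m c) {f : ℝ → ℝ} (hf : Continuous f) :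
    Integrable f m := by
  have := hm.prob
  obtain ⟨M, hM⟩ := (isCompact_Icc (a := (-1 : ℝ)) (b := 1)).exists_bound_of_continuousOn
    hf.continuousOn
  refine Integrable.of_bound hf.aestronglyMeasurable M ?_
  filter_upwards [hm.ae_abs_le] with t ht using hM t (abs_le.1 ht)

theorem IsBetaLaw.integrable_prod (hm : IsBetaLaw m c)
    {f : EuclideanSpace ℝ (Fin d) × ℝ → ℝ} (hf : Continuous f) :
    Integrable f ((F d ν).prod m) := by
  have := hm.prob
  obtain ⟨M, hM⟩ := ((isCompact_closedBall (0 : EuclideanSpace ℝ (Fin d)) 1).prod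
    (isCompact_Icc (a := (-1 : ℝ)) (b := 1))).exists_bound_of_continuousOn hf.continuousOn
  refine Integrable.of_bound hf.aestronglyMeasurable M ?_
  filter_upwards [Measure.quasiMeasurePreserving_fst.ae (ae_mem_unitBall d ν),
    Measure.quasiMeasurePreserving_snd.ae hm.ae_abs_le] with z hz ht
  exact hM z ⟨hz, abs_le.1 ht⟩

theorem poch_half (j : ℕ) : poch (1 / 2) j * (4 ^ j * j.factorial) = (2 * j).factorial := by
  induction j with
  | zero => simp
  | succ j ih =>
    rw [poch_succ, show 2 * (j + 1) = 2 * j + 1 + 1 by ring, Nat.factorial_succ, Nat.factorial_succ,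
      Nat.factorial_succ]
    push_cast
    rw [← ih]
    ring

/-- This turns the even terms of a binomial expansion of exponent 2(i+j) into those of (‖a‖² +
b²)^(i+j). -/
theorem choose_mul_poch_half (i j : ℕ) :
    ((2 * i + 2 * j).choose (2 * i) : ℝ) * (poch (1 / 2) i * poch (1 / 2) j) =
      (i + j).choose i * poch (1 / 2) (i + j) := by
  have h1 : ((2 * i + 2 * j).choose (2 * i) : ℝ) * (2 * i).factorial * (2 * j).factorial =
      (2 * i + 2 * j).factorial := by
    rw [Nat.choose_symm_add]
    exact_mod_cast Nat.add_choose_mul_factorial_mul_factorial (2 * i) (2 * j)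
  have h2 : ((i + j).choose i : ℝ) * i.factorial * j.factorial = (i + j).factorial := by
    rw [Nat.choose_symm_add]
    exact_mod_cast Nat.add_choose_mul_factorial_mul_factorial i j
  rw [← mul_add, ← poch_half, ← poch_half, ← poch_half, ← h2, pow_add] at h1
  have hK : (4 ^ i * 4 ^ j * (i.factorial * j.factorial) : ℝ) ≠ 0 := by positivity
  rw [mul_add] at h1
  apply mul_right_cancel₀ hK
  linear_combination h1

theorem sum_range_even {f : ℕ → ℝ} (hf : ∀ i, f (2 * i + 1) = 0) (k : ℕ) :
    ∑ l ∈ Finset.range (2 * k + 1), f l = ∑ i ∈ Finset.range (k + 1), f (2 * i) := by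
  induction k with
  | zero => simp
  | succ k ih =>
    rw [Finset.sum_range_succ _ (k + 1), ← ih, show 2 * (k + 1) + 1 = 2 * k + 1 + 1 + 1 by ring,
      Finset.sum_range_succ, Finset.sum_range_succ, hf, add_zero]
    rfl

/-- The height of the point of the upper unit hemisphere above a point of the unit ball. -/
def height (y : EuclideanSpace ℝ (Fin d)) : ℝ := √(1 - ‖y‖ ^ 2)

theorem continuous_height : Continuous (height (d := d)) := by unfold height; fun_prop

theorem height_sq {y : EuclideanSpace ℝ (Fin d)} (hy : ‖y‖ ≤ 1) : height y ^ 2 = 1 - ‖y‖ ^ 2 :=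
  sq_sqrt (by nlinarith [norm_nonneg y])

theorem integral_inner_pow_mul_height_pow (hd : 1 ≤ d) (hν : 0 ≤ ν)
    (a : EuclideanSpace ℝ (Fin d)) (i j : ℕ) :
    ∫ y, inner ℝ a y ^ (2 * i) * height y ^ (2 * j) ∂(F d ν) =
      ‖a‖ ^ (2 * i) * (poch (1 / 2) i * poch (ν + 1 / 2) j / poch (ν + 1 / 2 + d / 2) (i + j)) := by
  rw [← integral_F_inner_pow hd (by linarith)]
  refine integral_congr_ae ?_
  filter_upwards [ae_mem_unitBall d ν] with y hy
  rw [pow_mul (height y), height_sq (by simpa using hy)]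

theorem integral_inner_pow_odd_mul_height_pow
    (a : EuclideanSpace ℝ (Fin d)) (i j : ℕ) :
    ∫ y, inner ℝ a y ^ (2 * i + 1) * height y ^ (2 * j) ∂(F d ν) = 0 := by
  rw [← integral_F_inner_pow_odd a i j]
  refine integral_congr_ae ?_
  filter_upwards [ae_mem_unitBall d ν] with y hy
  rw [pow_mul (height y), height_sq (by simpa using hy)]

/-- The moments of a linear form on `ℝᵈ × ℝ` for the law of `(y, t √(1 - ‖y‖²))`. -/
theorem integral_lift_pow (hd : 1 ≤ d) (hν : 0 ≤ ν) (hm : IsBetaLaw m (ν + 1 / 2))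
    (a : EuclideanSpace ℝ (Fin d)) (b : ℝ) (M : ℕ) :
    ∫ z, (inner ℝ a z.1 + b * (z.2 * height z.1)) ^ M ∂((F d ν).prod m) =
      (‖a‖ ^ 2 + b ^ 2) ^ (M / 2) * gmom (ν + 1 / 2 + d / 2) M := by
  have := hm.prob
  have hcont := continuous_height (d := d)
  have hterm : ∀ l k : ℕ, ∫ z : EuclideanSpace ℝ (Fin d) × ℝ,
      inner ℝ a z.1 ^ l * (b * (z.2 * height z.1)) ^ k * (M.choose l : ℝ) ∂((F d ν).prod m) =
      (M.choose l : ℝ) * b ^ k * ((∫ y, inner ℝ a y ^ l * height y ^ k ∂(F d ν)) *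
        gmom (ν + 1 / 2) k) := by
    intro l k
    rw [← hm.moment, ← integral_prod_mul, ← integral_const_mul]
    congr 1
    ext z
    ring
  simp only [add_pow]
  rw [integral_finsetSum _ fun l _ => hm.integrable_prod (by fun_prop)]
  simp only [hterm]
  obtain ⟨k, rfl | rfl⟩ := Nat.even_or_odd' M
  · rw [sum_range_even, gmom_two_mul, Nat.mul_div_cancel_left _ two_pos, Finset.sum_mul]
    · refine Finset.sum_congr rfl fun i hi => ?_
      obtain ⟨j, rfl⟩ : ∃ j, k = i + j := ⟨k - i, by simp at hi; omega⟩
      rw [show 2 * (i + j) - 2 * i = 2 * j by omega, add_tsub_cancel_left,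
        integral_inner_pow_mul_height_pow hd hν, gmom_two_mul, mul_add]
      have h := choose_mul_poch_half i j
      have p1 := poch_pos (x := ν + 1 / 2) (by positivity) j
      have : poch (ν + 1 / 2) j / poch (ν + 1 / 2) j = 1 := div_self p1.ne'
      simp only [pow_mul]
      linear_combination ((‖a‖ ^ 2) ^ i * (b ^ 2) ^ j / poch (ν + 1 / 2 + d / 2) (i + j)) * h +
        (((2 * i + 2 * j).choose (2 * i) : ℝ) * (poch (1 / 2) i * poch (1 / 2) j) *
        (‖a‖ ^ 2) ^ i * (b ^ 2) ^ j / poch (ν + 1 / 2 + d / 2) (i + j)) * this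
    -- Odd powers of t have zero mean, so only even powers of `height` survive, and these are
    -- polynomials on the ball.
    · intro i
      by_cases h : i < k
      · rw [show 2 * k - (2 * i + 1) = 2 * (k - i - 1) + 1 by omega, gmom_two_mul_add_one]; simp
      · rw [Nat.choose_eq_zero_of_lt (by omega)]; simp
  · rw [gmom_two_mul_add_one, mul_zero]
    refine Finset.sum_eq_zero fun l hl => ?_
    obtain ⟨i, rfl | rfl⟩ := Nat.even_or_odd' l
    · simp at hl
      rw [show 2 * k + 1 - 2 * i = 2 * (k - i) + 1 by omega, gmom_two_mul_add_one]; simp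
    · rw [show 2 * k + 1 - (2 * i + 1) = 2 * (k - i) by omega,
        integral_inner_pow_odd_mul_height_pow]
      simp

end Lift

end

end BallPoly

/-! ### Joint moments and conditional expectations -/

namespace BallPoly

noncomputable section

open Set Real

section Transport

variable {d : ℕ} {ν c : ℝ} {m : Measure ℝ}

theorem integral_add_mul_pow_eq_eval {Ω : Type*} [MeasurableSpace Ω] {P : Measure Ω} {u v : Ω → ℝ}
    (hi : ∀ p k : ℕ, Integrable (fun z => u z ^ p * v z ^ k) P) (M : ℕ) (τ : ℝ) :
    ∫ z, (u z + τ * v z) ^ M ∂P =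
      (∑ l ∈ Finset.range (M + 1), Polynomial.C ((M.choose l : ℝ) *
        ∫ z, u z ^ (M - l) * v z ^ l ∂P) * Polynomial.X ^ l).eval τ := by
  have e : ∀ z, (u z + τ * v z) ^ M = ∑ l ∈ Finset.range (M + 1),
      ((M.choose l : ℝ) * τ ^ l) * (u z ^ (M - l) * v z ^ l) := fun z => by
    rw [add_comm, add_pow]
    exact Finset.sum_congr rfl fun l _ => by ring
  simp only [e]
  rw [integral_finsetSum _ fun l _ => (hi _ _).const_mul _, Polynomial.eval_finsetSum]
  refine Finset.sum_congr rfl fun l _ => ?_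
  rw [integral_const_mul]
  simp only [Polynomial.eval_mul, Polynomial.eval_C, Polynomial.eval_pow, Polynomial.eval_X]
  ring

/-- Polarization: the mixed moments are, up to binomial coefficients, the coefficients in τ of the
moments of u + τv. -/
theorem integral_pow_mul_pow_eq {Ω₁ Ω₂ : Type*} [MeasurableSpace Ω₁] [MeasurableSpace Ω₂]
    {P₁ : Measure Ω₁} {P₂ : Measure Ω₂} {u₁ v₁ : Ω₁ → ℝ} {u₂ v₂ : Ω₂ → ℝ}
    (h₁ : ∀ p k : ℕ, Integrable (fun z => u₁ z ^ p * v₁ z ^ k) P₁)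
    (h₂ : ∀ p k : ℕ, Integrable (fun z => u₂ z ^ p * v₂ z ^ k) P₂)
    (h : ∀ (M : ℕ) (τ : ℝ), ∫ z, (u₁ z + τ * v₁ z) ^ M ∂P₁ = ∫ z, (u₂ z + τ * v₂ z) ^ M ∂P₂)
    (p k : ℕ) : ∫ z, u₁ z ^ p * v₁ z ^ k ∂P₁ = ∫ z, u₂ z ^ p * v₂ z ^ k ∂P₂ := by
  have key := Polynomial.funext fun τ => (integral_add_mul_pow_eq_eval h₁ (p + k) τ).symm.trans
    ((h (p + k) τ).trans (integral_add_mul_pow_eq_eval h₂ (p + k) τ))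
  have hc := congrArg (fun Q => Polynomial.coeff Q k) key
  simp only [Polynomial.finsetSum_coeff, Polynomial.coeff_C_mul, Polynomial.coeff_X_pow, mul_ite,
    mul_one, mul_zero, Finset.sum_ite_eq, Finset.mem_range] at hc
  rw [if_pos (by omega), if_pos (by omega), Nat.add_sub_cancel] at hc
  have hpos : ((p + k).choose k : ℝ) ≠ 0 := by
    exact_mod_cast (Nat.choose_pos (Nat.le_add_left k p)).ne'
  exact mul_left_cancel₀ hpos hc

/-- The inner product of the lift `(x, √(1 - ‖x‖²))` with `(y, t √(1 - ‖y‖²))`. -/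
def liftInner (x : EuclideanSpace ℝ (Fin d)) (z : EuclideanSpace ℝ (Fin d) × ℝ) : ℝ :=
  inner ℝ x z.1 + height x * (z.2 * height z.1)

theorem continuous_liftInner (x : EuclideanSpace ℝ (Fin d)) : Continuous (liftInner x) := by
  have := continuous_height (d := d)
  unfold liftInner
  fun_prop

/-- Rotation invariance in the form used later: given `liftInner x z` = s, the form ⟨a, y⟩ behaves
like ⟨a,x⟩ s plus an independent symmetric variable scaled by √(1-s²). -/
theorem integral_inner_pow_mul_liftInner_pow (hd : 1 ≤ d) (hν : 0 ≤ ν)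
    (hm : IsBetaLaw m (ν + 1 / 2)) {lam : ℝ} (hlam : lam = ν + (d - 1) / 2) {m' : Measure ℝ}
    (hm' : IsBetaLaw m' (lam + 1 / 2)) {x : EuclideanSpace ℝ (Fin d)} (hx : ‖x‖ ≤ 1)
    (a : EuclideanSpace ℝ (Fin d)) (p k : ℕ) :
    ∫ z, inner ℝ a z.1 ^ p * liftInner x z ^ k ∂((F d ν).prod m) =
      ∫ w, (inner ℝ a x * w.1 0 + √(‖a‖ ^ 2 - inner ℝ a x ^ 2) * (w.2 * height w.1)) ^ p *
        w.1 0 ^ k ∂((F 1 lam).prod m') := by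
  have hcd := continuous_height (d := d)
  have hc1 := continuous_height (d := 1)
  have hcl := continuous_liftInner x
  have hd' : (1 : ℝ) ≤ d := by exact_mod_cast hd
  refine integral_pow_mul_pow_eq (fun p k => hm.integrable_prod (by fun_prop))
    (fun p k => hm'.integrable_prod (by fun_prop)) (fun M τ => ?_) p k
  have e1 : ∀ z : EuclideanSpace ℝ (Fin d) × ℝ, inner ℝ a z.1 + τ * liftInner x z =
      inner ℝ (a + τ • x) z.1 + (τ * height x) * (z.2 * height z.1) := fun z => by
    rw [liftInner, inner_add_left, real_inner_smul_left]; ring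
  have e2 : ∀ w : EuclideanSpace ℝ (Fin 1) × ℝ,
      inner ℝ a x * w.1 0 + √(‖a‖ ^ 2 - inner ℝ a x ^ 2) * (w.2 * height w.1) + τ * w.1 0 =
      inner ℝ (EuclideanSpace.single 0 (inner ℝ a x + τ)) w.1 +
        √(‖a‖ ^ 2 - inner ℝ a x ^ 2) * (w.2 * height w.1) := fun w => by
    rw [inner_single_one]; ring
  simp only [e1, e2]
  rw [integral_lift_pow hd hν hm, integral_lift_pow le_rfl (by rw [hlam]; linarith) hm']
  congr 2
  -- Both linear forms have squared length ‖a‖² + 2τ⟨a,x⟩ + τ², the only quantity on which their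
  -- moments depend.
  · rw [norm_add_sq_real, norm_smul, mul_pow, mul_pow, height_sq hx, sq_sqrt]
    · simp only [PiLp.norm_single, norm_eq_abs, sq_abs, inner_smul_right]
      ring
    · have h := abs_real_inner_le_norm a x
      have h2 : |inner ℝ a x| ≤ ‖a‖ :=
        h.trans (mul_le_of_le_one_right (norm_nonneg a) hx)
      have := sq_le_sq' (by linarith [abs_nonneg (inner ℝ a x), norm_nonneg a]) h2
      rw [sq_abs] at this
      linarith
  · rw [hlam]; push_cast; ring

theorem IsBetaLaw.integral_add_mul_pow (hm : IsBetaLaw m c) (u b h : ℝ) (p : ℕ) :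
    ∫ t, (u + b * (t * h)) ^ p ∂m =
      ∑ l ∈ Finset.range (p + 1),
        (p.choose l * b ^ (p - l) * gmom c (p - l)) * u ^ l * (h ^ 2) ^ ((p - l) / 2) := by
  simp only [add_pow]
  rw [integral_finsetSum _ fun l _ => hm.integrable_of_continuous (by fun_prop)]
  refine Finset.sum_congr rfl fun l _ => ?_
  have e : ∀ t : ℝ, u ^ l * (b * (t * h)) ^ (p - l) * (p.choose l : ℝ) =
      (u ^ l * b ^ (p - l) * h ^ (p - l) * p.choose l) * t ^ (p - l) := fun t => by ring
  simp only [e]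
  rw [integral_const_mul, hm.moment]
  obtain ⟨i, hi | hi⟩ := Nat.even_or_odd' (p - l)
  · rw [hi, Nat.mul_div_cancel_left _ two_pos, ← pow_mul]; ring
  · rw [hi, gmom_two_mul_add_one]; simp

-- The square root enters only through even powers, so averaging over t leaves a polynomial in s. At
-- s = 1 the random term vanishes, leaving u^p.
open Polynomial in
theorem IsBetaLaw.exists_polynomial (hm : IsBetaLaw m c) (u b : ℝ) (p : ℕ) :
    ∃ g : ℝ[X], g.natDegree ≤ p ∧ g.eval 1 = u ^ p ∧ ∀ y : EuclideanSpace ℝ (Fin 1), ‖y‖ ≤ 1 →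
      g.eval (y 0) = ∫ t, (u * y 0 + b * (t * height y)) ^ p ∂m := by
  have hp := hm.prob
  have hev : ∀ s h : ℝ, h ^ 2 = 1 - s ^ 2 → (∑ l ∈ Finset.range (p + 1),
      C (p.choose l * b ^ (p - l) * gmom c (p - l)) * (C u * X) ^ l *
        (1 - X ^ 2) ^ ((p - l) / 2)).eval s = ∫ t, (u * s + b * (t * h)) ^ p ∂m := by
    intro s h hs
    rw [hm.integral_add_mul_pow, eval_finsetSum]
    refine Finset.sum_congr rfl fun l _ => ?_
    simp only [eval_mul, eval_C, eval_pow, eval_X, eval_sub, eval_one, hs]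
  refine ⟨_, ?_, ?_, fun y hy => hev _ (height y) ?_⟩
  · refine natDegree_sum_le_of_forall_le _ _ fun l hl => ?_
    have hl : l < p + 1 := by simpa using hl
    have h1 : ((C u * X) ^ l : ℝ[X]).natDegree ≤ l := by compute_degree
    have h2 : ((1 - X ^ 2 : ℝ[X]) ^ ((p - l) / 2)).natDegree ≤ (p - l) / 2 * 2 :=
      natDegree_pow_le_of_le _ (by compute_degree)
    rw [mul_assoc]
    refine (natDegree_C_mul_le _ _).trans (natDegree_mul_le.trans ?_)
    omega
  · rw [hev 1 0 (by norm_num)]; simp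
  · rw [height_sq hy, EuclideanSpace.real_norm_sq_eq]; simp

open MvPolynomial

/-- The linear form `⟨a, ·⟩` as a polynomial. -/
def linForm (a : EuclideanSpace ℝ (Fin d)) : MvPolynomial (Fin d) ℝ := ∑ i, C (a i) * X i

theorem polyFun_linForm (a y : EuclideanSpace ℝ (Fin d)) : polyFun (linForm a) y = inner ℝ a y := by
  simp [polyFun, linForm, PiLp.inner_apply, mul_comm]

theorem totalDegree_linForm_le (a : EuclideanSpace ℝ (Fin d)) : (linForm a).totalDegree ≤ 1 := by
  refine totalDegree_finsetSum_le fun i _ => ?_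
  exact (totalDegree_mul _ _).trans (by simp)

theorem polyFun_one_sub_sq (y : EuclideanSpace ℝ (Fin d)) :
    polyFun (1 - ∑ i, X i ^ 2) y = 1 - ‖y‖ ^ 2 := by
  simp [polyFun, EuclideanSpace.real_norm_sq_eq]

theorem totalDegree_one_sub_sq_le :
    (1 - ∑ i, X i ^ 2 : MvPolynomial (Fin d) ℝ).totalDegree ≤ 2 := by
  refine (totalDegree_sub _ _).trans (max_le (by simp) ?_)
  exact totalDegree_finsetSum_le fun i _ => by simp

theorem IsBetaLaw.exists_mvPolynomial (hm : IsBetaLaw m c) (x : EuclideanSpace ℝ (Fin d)) (p : ℕ) :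
    ∃ P : MvPolynomial (Fin d) ℝ, P.totalDegree ≤ p ∧ ∀ y : EuclideanSpace ℝ (Fin d), ‖y‖ ≤ 1 →
      polyFun P y = ∫ t, liftInner x (y, t) ^ p ∂m := by
  refine ⟨∑ l ∈ Finset.range (p + 1), C (p.choose l * height x ^ (p - l) * gmom c (p - l)) *
    linForm x ^ l * (1 - ∑ i, X i ^ 2) ^ ((p - l) / 2), ?_, fun y hy => ?_⟩
  · refine totalDegree_finsetSum_le fun l hl => ?_
    have hl : l < p + 1 := by simpa using hl
    have h1 := (totalDegree_pow (linForm x) l).trans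
      (Nat.mul_le_mul_left l (totalDegree_linForm_le x))
    have h2 := (totalDegree_pow (1 - ∑ i, X i ^ 2 : MvPolynomial (Fin d) ℝ) ((p - l) / 2)).trans
      (Nat.mul_le_mul_left _ totalDegree_one_sub_sq_le)
    have h3 := totalDegree_mul
      (C (p.choose l * height x ^ (p - l) * gmom c (p - l)) * linForm x ^ l)
      ((1 - ∑ i, X i ^ 2) ^ ((p - l) / 2))
    have h4 := totalDegree_mul
      (C (p.choose l * height x ^ (p - l) * gmom c (p - l))) (linForm x ^ l)
    rw [totalDegree_C] at h4
    omega
  · simp only [liftInner]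
    rw [hm.integral_add_mul_pow]
    have e : ∀ Q : MvPolynomial (Fin d) ℝ, polyFun Q y = eval (fun i => y i) Q := fun _ => rfl
    rw [e, map_sum]
    refine Finset.sum_congr rfl fun l _ => ?_
    rw [map_mul, map_mul, map_pow, map_pow, eval_C, ← e, ← e, polyFun_linForm, polyFun_one_sub_sq,
      height_sq hy]

/-- Powers of linear forms of exponent at most `n` span the polynomials of degree at most `n`. -/
theorem mem_of_linForm_pow_mem {n : ℕ} {S : Submodule ℝ (MvPolynomial (Fin d) ℝ)}
    (hS : ∀ a, ∀ p ≤ n, linForm a ^ p ∈ S) {q : MvPolynomial (Fin d) ℝ} (hq : q.totalDegree ≤ n) :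
    q ∈ S := by
  rw [q.as_sum]
  refine S.sum_mem fun s hs => ?_
  by_contra hns
  obtain ⟨φ, hφ, hker⟩ := Submodule.exists_le_ker_of_notMem hns
  set p := ∑ i, s i with hp
  have hpn : p ≤ n := by
    refine le_trans ?_ ((le_totalDegree hs).trans hq)
    rw [Finsupp.sum_fintype _ _ (fun _ => rfl)]
  -- Q(b) is φ applied to the p-th power of the linear form b, hence zero for every b. The
  -- coefficient of Q at s is a positive multinomial coefficient times φ of the monomial,
  -- contradicting the choice of φ.
  set Q : MvPolynomial (Fin d) ℝ := ∑ k ∈ Finset.piAntidiag Finset.univ p,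
    monomial (Finsupp.equivFunOnFinite.symm k)
      ((Nat.multinomial Finset.univ k : ℝ) * φ (∏ i, X i ^ k i)) with hQ
  have hQ0 : Q = 0 := by
    refine MvPolynomial.funext fun b => ?_
    have h0 : φ (linForm (WithLp.toLp 2 b) ^ p) = 0 := hker (hS _ p hpn)
    rw [linForm, Finset.sum_pow_eq_sum_piAntidiag, map_sum] at h0
    rw [map_zero, ← h0, hQ, map_sum]
    refine Finset.sum_congr rfl fun k _ => ?_
    have e : (Nat.multinomial Finset.univ k : MvPolynomial (Fin d) ℝ) *
        ∏ i, (C (b i) * X i) ^ k i =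
        ((Nat.multinomial Finset.univ k : ℝ) * ∏ i, b i ^ k i) • ∏ i, X i ^ k i := by
      rw [smul_eq_C_mul]
      simp only [mul_pow, Finset.prod_mul_distrib, map_mul, map_natCast, map_prod, map_pow]
      ring
    rw [e, map_smul, eval_monomial, Finsupp.prod_fintype _ _ (by simp)]
    simp
    ring
  have hcoeff := congrArg (coeff s) hQ0
  rw [hQ, coeff_sum, Finset.sum_eq_single_of_mem (⇑s) (by simp [hp])] at hcoeff
  · rw [coeff_monomial, if_pos (by ext; simp), coeff_zero, mul_eq_zero] at hcoeff
    rcases hcoeff with h | h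
    · exact (Nat.multinomial_pos _ _).ne' (by exact_mod_cast h)
    · apply hφ
      rw [monomial_eq, Finsupp.prod_fintype _ _ (by simp), ← smul_eq_C_mul, map_smul, h, smul_zero]
  · intro k _ hk
    rw [coeff_monomial, if_neg]
    rintro rfl
    exact hk (by simp)

end Transport

end

end BallPoly

/-! ### The point evaluation bound -/

namespace BallPoly

noncomputable section

open Set Real

section Bound

variable {d : ℕ} {ν : ℝ} {m : Measure ℝ}

open Polynomial in
/-- Integration of polynomials against the Gegenbauer weight `(1 - s²)^(λ - 1/2)`. -/
def gegenbauer (lam : ℝ) : ℝ[X] →ₗ[ℝ] ℝ where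
  toFun f := ∫ y, f.eval (y 0) ∂(F 1 lam)
  map_add' f g := by
    simp only [eval_add]
    exact integral_add (integrable_of_continuous (by fun_prop))
      (integrable_of_continuous (by fun_prop))
  map_smul' r f := by
    simp only [eval_smul, smul_eq_mul, RingHom.id_apply]
    exact integral_const_mul _ _

theorem gegenbauer_apply (lam : ℝ) (f : Polynomial ℝ) :
    gegenbauer lam f = ∫ y, f.eval (y 0) ∂(F 1 lam) := rfl

theorem isGegenbauer_gegenbauer {lam : ℝ} (hlam : 0 ≤ lam) :
    IsGegenbauer (gegenbauer lam) lam where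
  even i := by
    simp only [gegenbauer_apply, Polynomial.eval_pow, Polynomial.eval_X]
    rw [integral_F_one_pow (by linarith), gmom_two_mul]
  odd i := by
    simp only [gegenbauer_apply, Polynomial.eval_pow, Polynomial.eval_X]
    rw [integral_F_one_pow (by linarith), gmom_two_mul_add_one]

/-- The polynomials `q` that have a conditional expectation `g`, given `⟨(x, √(1 - ‖x‖²)), ·⟩`,
that is a polynomial of degree at most `n`. -/
def averaged (hm : IsBetaLaw m (ν + 1 / 2)) (lam : ℝ) (n : ℕ) (x : EuclideanSpace ℝ (Fin d)) :
    Submodule ℝ (MvPolynomial (Fin d) ℝ) where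
  carrier := {q | ∃ g : Polynomial ℝ, g.natDegree ≤ n ∧ g.eval 1 = polyFun q x ∧
    ∀ k, gegenbauer lam (g * Polynomial.X ^ k) =
      ∫ z, polyFun q z.1 * liftInner x z ^ k ∂((F d ν).prod m)}
  zero_mem' := ⟨0, by simp, by simp [polyFun], by simp [polyFun]⟩
  add_mem' := by
    rintro q q' ⟨g, h1, h2, h3⟩ ⟨g', h1', h2', h3'⟩
    have hcl := continuous_liftInner x
    have hq := continuous_polyFun q
    have hq' := continuous_polyFun q'
    refine ⟨g + g', (Polynomial.natDegree_add_le_of_le h1 h1').trans (max_self n).le, ?_,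
      fun k => ?_⟩
    · rw [Polynomial.eval_add, h2, h2']; simp [polyFun]
    · rw [add_mul, map_add, h3, h3', ← integral_add (hm.integrable_prod (by fun_prop))
        (hm.integrable_prod (by fun_prop))]
      simp [polyFun, add_mul]
  smul_mem' := by
    rintro r q ⟨g, h1, h2, h3⟩
    refine ⟨r • g, (Polynomial.natDegree_smul_le r g).trans h1, ?_, fun k => ?_⟩
    · rw [Polynomial.eval_smul, h2]; simp [polyFun]
    · rw [smul_mul_assoc, map_smul, h3, smul_eq_mul, ← integral_const_mul]
      simp [polyFun, mul_assoc]

/-- The conditional expectation is explicit here: average (⟨a,x⟩ s + √(‖a‖² - ⟨a,x⟩²) √(1-s²) t)^p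
over t. -/
theorem linForm_pow_mem_averaged (hd : 1 ≤ d) (hν : 0 ≤ ν) (hm : IsBetaLaw m (ν + 1 / 2)) {lam : ℝ}
    (hlam : lam = ν + (d - 1) / 2) {n : ℕ} {x : EuclideanSpace ℝ (Fin d)} (hx : ‖x‖ ≤ 1)
    (a : EuclideanSpace ℝ (Fin d)) {p : ℕ} (hp : p ≤ n) :
    linForm a ^ p ∈ averaged hm lam n x := by
  have hd' : (1 : ℝ) ≤ d := by exact_mod_cast hd
  obtain ⟨m', hm'⟩ := exists_isBetaLaw (c := lam + 1 / 2) (by rw [hlam]; linarith)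
  have := hm'.prob
  have hpoly : ∀ y, polyFun (linForm a ^ p) y = inner ℝ a y ^ p := fun y => by
    rw [← polyFun_linForm]; simp [polyFun]
  obtain ⟨g, h1, h2, h3⟩ := hm'.exists_polynomial (inner ℝ a x) (√(‖a‖ ^ 2 - inner ℝ a x ^ 2)) p
  refine ⟨g, h1.trans hp, by rw [h2, hpoly], fun k => ?_⟩
  have hc1 := continuous_height (d := 1)
  simp only [hpoly]
  rw [integral_inner_pow_mul_liftInner_pow hd hν hm hlam hm' hx,
    integral_prod _ (hm'.integrable_prod (by fun_prop)), gegenbauer_apply]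
  refine integral_congr_ae ?_
  filter_upwards [ae_mem_unitBall 1 lam] with y hy
  simp only [Polynomial.eval_mul, Polynomial.eval_pow, Polynomial.eval_X]
  rw [integral_mul_const, h3 y (by simpa using hy)]

theorem gegenbauer_mul_eq (hm : IsBetaLaw m (ν + 1 / 2)) {lam : ℝ}
    {x : EuclideanSpace ℝ (Fin d)} {q : MvPolynomial (Fin d) ℝ} {g : Polynomial ℝ}
    (hg : ∀ k, gegenbauer lam (g * Polynomial.X ^ k) =
      ∫ z, polyFun q z.1 * liftInner x z ^ k ∂((F d ν).prod m)) (h : Polynomial ℝ) :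
    gegenbauer lam (g * h) =
      ∫ z, polyFun q z.1 * h.eval (liftInner x z) ∂((F d ν).prod m) := by
  have hcl := continuous_liftInner x
  have hq := continuous_polyFun q
  induction h using Polynomial.induction_on' with
  | add h h' ih ih' =>
    rw [mul_add, map_add, ih, ih', ← integral_add (hm.integrable_prod (by fun_prop))
        (hm.integrable_prod (by fun_prop))]
    simp [mul_add]
  | monomial k r =>
    rw [← Polynomial.C_mul_X_pow_eq_monomial, mul_left_comm, ← Polynomial.smul_eq_C_mul, map_smul,
      hg, smul_eq_mul, ← integral_const_mul]
    simp [mul_left_comm]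

/-- Point evaluation on `𝒴ₙ` is bounded by the norm times `n ^ λ`, up to a constant. -/
theorem polyFun_sq_le (hd : 1 ≤ d) (hν : 0 ≤ ν) {lam : ℝ} (hlam : lam = ν + (d - 1) / 2) {n : ℕ}
    (hn : 1 ≤ n) {x : EuclideanSpace ℝ (Fin d)} (hx : ‖x‖ ≤ 1) {q : MvPolynomial (Fin d) ℝ}
    (hq : q ∈ Y d ν n) :
    polyFun q x ^ 2 ≤
      (2 * lam + 2) * Real.exp (2 * lam) * (n : ℝ) ^ (2 * lam) * polyInner d ν q q := by
  have hd' : (1 : ℝ) ≤ d := by exact_mod_cast hd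
  have hlam0 : 0 ≤ lam := by rw [hlam]; linarith
  obtain ⟨m, hm⟩ := exists_isBetaLaw (c := ν + 1 / 2) (by linarith)
  have := hm.prob
  have := isProbabilityMeasure_F (d := d) hd (κ := ν) (by linarith)
  have hcl := continuous_liftInner x
  have hqc := continuous_polyFun q
  obtain ⟨g, h1, h2, h3⟩ := mem_of_linForm_pow_mem
    (fun a p hp => linForm_pow_mem_averaged hd hν hm hlam hx a hp) hq.1
  have horth : ∀ k < n, gegenbauer lam (g * Polynomial.X ^ k) = 0 := by
    intro k hk
    obtain ⟨P, hP, hPy⟩ := hm.exists_mvPolynomial x k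
    rw [h3, integral_prod _ (hm.integrable_prod (by fun_prop)),
      ← hq.2 P (hP.trans_lt hk), polyInner]
    refine integral_congr_ae ?_
    filter_upwards [ae_mem_unitBall d ν] with y hy
    rw [integral_const_mul, hPy y (by simpa using hy)]
  -- The law of `liftInner x` is the Gegenbauer weight: the case p = 0 of the joint moments.
  have hone : ∀ h : Polynomial ℝ,
      gegenbauer lam h = ∫ z, h.eval (liftInner x z) ∂((F d ν).prod m) := by
    intro h
    obtain ⟨m', hm'⟩ := exists_isBetaLaw (c := lam + 1 / 2) (by linarith)
    have := hm'.prob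
    have hk : ∀ k, gegenbauer lam (1 * Polynomial.X ^ k) =
        ∫ z, polyFun (1 : MvPolynomial (Fin d) ℝ) z.1 * liftInner x z ^ k ∂((F d ν).prod m) := by
      intro k
      have := integral_inner_pow_mul_liftInner_pow hd hν hm hlam hm' hx 0 0 k
      simp only [pow_zero, one_mul] at this
      simp only [polyFun, map_one, one_mul]
      rw [this, integral_fun_fst (fun y : EuclideanSpace ℝ (Fin 1) => y 0 ^ k), gegenbauer_apply]
      simp
    have := gegenbauer_mul_eq hm hk h
    simpa [polyFun] using this
  -- Pythagoras: the cross term E[q g] equals E[g²], so 0 ≤ E[(q - g)²] = E[q²] - E[g²].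
  have hnorm : gegenbauer lam (g * g) ≤ polyInner d ν q q := by
    have hpos : 0 ≤ ∫ z, (polyFun q z.1 - g.eval (liftInner x z)) ^ 2 ∂((F d ν).prod m) :=
      integral_nonneg fun z => sq_nonneg _
    have e : ∀ z : EuclideanSpace ℝ (Fin d) × ℝ, (polyFun q z.1 - g.eval (liftInner x z)) ^ 2 =
        polyFun q z.1 * polyFun q z.1 + (g * g).eval (liftInner x z) -
          2 * (polyFun q z.1 * g.eval (liftInner x z)) := fun z => by
      rw [Polynomial.eval_mul]; ring
    simp only [e] at hpos
    rw [integral_sub (hm.integrable_prod (by fun_prop)) (hm.integrable_prod (by fun_prop)),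
      integral_add (hm.integrable_prod (by fun_prop)) (hm.integrable_prod (by fun_prop)),
      integral_const_mul, ← hone, ← gegenbauer_mul_eq hm h3,
      integral_fun_fst (fun y => polyFun q y * polyFun q y)] at hpos
    simp only [probReal_univ, one_smul] at hpos
    rw [polyInner]
    linarith
  rw [← h2]
  refine ((isGegenbauer_gegenbauer hlam0).eval_one_sq_le hlam0 hn h1 horth).trans ?_
  gcongr

theorem polyInner_sum_smul {ι : Type*} [Fintype ι] [DecidableEq ι]
    {p : ι → MvPolynomial (Fin d) ℝ}
    (hp : ∀ j k, polyInner d ν (p j) (p k) = if j = k then 1 else 0) (r : ι → ℝ) :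
    polyInner d ν (∑ k, r k • p k) (∑ k, r k • p k) = ∑ k, r k ^ 2 := by
  have e : ∀ y, polyFun (∑ k, r k • p k) y * polyFun (∑ k, r k • p k) y =
      ∑ j, ∑ k, r j * r k * (polyFun (p j) y * polyFun (p k) y) := fun y => by
    simp only [polyFun, map_sum, MvPolynomial.smul_eval, Finset.sum_mul_sum]
    exact Finset.sum_congr rfl fun j _ => Finset.sum_congr rfl fun k _ => by ring
  unfold polyInner
  simp only [e]
  rw [integral_finsetSum _ fun j _ => integrable_finsetSum _ fun k _ =>
    (integrable_mul d ν _ _).const_mul _]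
  refine Finset.sum_congr rfl fun j _ => ?_
  rw [integral_finsetSum _ fun k _ => (integrable_mul d ν _ _).const_mul _]
  have h : ∀ k, ∫ y, r j * r k * (polyFun (p j) y * polyFun (p k) y) ∂(F d ν) =
      if j = k then r j * r k else 0 := fun k => by
    rw [integral_const_mul, ← polyInner, hp]; simp
  simp only [h]
  simp [sq]

/-- The point evaluation bound is applied to the reproducing kernel ∑ pₖ(x) pₖ, whose value at x and
squared norm are both S. -/
theorem sum_sq_le (hd : 1 ≤ d) (hν : 0 ≤ ν) {lam : ℝ} (hlam : lam = ν + (d - 1) / 2) {n : ℕ}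
    (hn : 1 ≤ n) {x : EuclideanSpace ℝ (Fin d)} (hx : ‖x‖ ≤ 1)
    {p : Module.Basis (Fin (Module.finrank ℝ (Y d ν n))) ℝ (Y d ν n)} (hp : IsOrthonormalBasis p) :
    ∑ k, polyFun (p k : MvPolynomial (Fin d) ℝ) x ^ 2 ≤
      (2 * lam + 2) * Real.exp (2 * lam) * (n : ℝ) ^ (2 * lam) := by
  have hd' : (1 : ℝ) ≤ d := by exact_mod_cast hd
  have hlam0 : 0 ≤ lam := by rw [hlam]; linarith
  set S := ∑ k, polyFun (p k : MvPolynomial (Fin d) ℝ) x ^ 2 with hS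
  have hS0 : 0 ≤ S := Finset.sum_nonneg fun k _ => sq_nonneg _
  have h := polyFun_sq_le hd hν hlam hn hx
    (Submodule.sum_mem _ fun k (_ : k ∈ Finset.univ) =>
      Submodule.smul_mem _ (polyFun (p k : MvPolynomial (Fin d) ℝ) x) (p k).2)
  rw [polyInner_sum_smul hp, ← hS] at h
  have e : polyFun (∑ k, polyFun (p k : MvPolynomial (Fin d) ℝ) x • (p k : MvPolynomial (Fin d) ℝ)) x
      = S := by
    rw [hS]
    simp only [polyFun, map_sum, MvPolynomial.smul_eval, sq]
  rw [e] at h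
  rcases hS0.eq_or_lt with h0 | h0
  · rw [← h0]; positivity
  · exact le_of_mul_le_mul_right (by rwa [sq] at h) h0

end Bound

end

end BallPoly

theorem lemma4p1 (d : ℕ) (hd : 1 ≤ d) (ν : ℝ) (hν : 0 ≤ ν) :
    ∃ C : ℝ, 0 < C ∧ ∀ n : ℕ, 1 ≤ n →
      ∀ p : Module.Basis (Fin (Module.finrank ℝ (BallPoly.Y d ν n))) ℝ (BallPoly.Y d ν n),
        BallPoly.IsOrthonormalBasis p →
        (∀ k, ‖BallPoly.onBall (p k : MvPolynomial (Fin d) ℝ)‖ ≤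
          C * (n : ℝ) ^ (ν + ((d : ℝ) - 1) / 2)) ∧
        ‖∑ k, BallPoly.onBall (p k : MvPolynomial (Fin d) ℝ) ^ 2‖ ≤
          C * (n : ℝ) ^ (2 * ν + (d : ℝ) - 1) := by
  have hd' : (1 : ℝ) ≤ d := by exact_mod_cast hd
  obtain ⟨lam, hlam⟩ : ∃ lam : ℝ, lam = ν + ((d : ℝ) - 1) / 2 := ⟨_, rfl⟩
  have hlam0 : 0 ≤ lam := by rw [hlam]; linarith
  obtain ⟨K, hK⟩ : ∃ K : ℝ, K = (2 * lam + 2) * Real.exp (2 * lam) := ⟨_, rfl⟩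
  have hK1 : 1 ≤ K := by
    rw [hK]
    have := Real.one_le_exp (show 0 ≤ 2 * lam by linarith)
    nlinarith
  refine ⟨K, by linarith, fun n hn p hp => ?_⟩
  have hsum : ∀ x : BallPoly.unitBall d,
      ∑ k, BallPoly.polyFun (p k : MvPolynomial (Fin d) ℝ) x ^ 2 ≤ K * (n : ℝ) ^ (2 * lam) :=
    fun x => hK ▸ BallPoly.sum_sq_le hd hν hlam hn (mem_closedBall_zero_iff.1 x.2) hp
  refine ⟨fun k => ?_, ?_⟩
  · rw [← hlam, ContinuousMap.norm_le _ (by positivity)]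
    intro x
    refine abs_le_of_sq_le_sq ?_ (by positivity)
    have h1 : BallPoly.polyFun (p k : MvPolynomial (Fin d) ℝ) x ^ 2 ≤ K * (n : ℝ) ^ (2 * lam) :=
      (Finset.single_le_sum
        (f := fun k => BallPoly.polyFun (p k : MvPolynomial (Fin d) ℝ) x ^ 2)
        (fun k _ => sq_nonneg _) (Finset.mem_univ k)).trans (hsum x)
    refine h1.trans ?_
    -- The square root of K would suffice; since K ≥ 1 gives K ≤ K², the same constant serves both
    -- bounds.
    rw [mul_pow, ← Real.rpow_mul_natCast (Nat.cast_nonneg n), Nat.cast_two, mul_comm lam 2]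
    gcongr
    nlinarith
  · rw [show 2 * ν + (d : ℝ) - 1 = 2 * lam by rw [hlam]; ring,
      ContinuousMap.norm_le _ (by positivity)]
    intro x
    rw [ContinuousMap.sum_apply, Real.norm_of_nonneg]
    · exact hsum x
    · exact Finset.sum_nonneg fun k _ => sq_nonneg _
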